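/- **Lemma.** Let $\mathbb K$ be a field of arbitrary characteristic and $G$ a finite group. For a subgroup $H\le G$ put $\mu_{\mathbb K}(H)=H^2(H,\mathbb K^\times)$ (trivial action). A $\mu_{\mathbb K}$-decorated $G$-set is a $G$-set $X$ with frills $\pi_x\in\mu_{\mathbb K}(G_x)$, $x\in X$, such that $\pi_{gx}$ is the pull-back of $\pi_x$ along $G_{gx}\to G_x$, $h\mapsto g^{-1}hg$. For a $G$-algebra $A$ over $\mathbb K$ (an associative unital $\mathbb K$-algebra on which $G$ acts by $\mathbb K$-algebra automorphisms) let $\mathrm{Irr}(A)$ be the decorated $G$-set of isomorphism classes of absolutely simple $A$-modules $M$ (simple with $\mathrm{End}_A(M)=\mathbb K$): $g\cdot[M]=[M^{[g^{-1}]}]$, where $M^{[g]}$ is $M$ with the action $a\cdot^{[g]}m=g(a)m$, and the frill of $[M]$ is the class of $\theta_M$, where $T_g:M\to M$ ($g\in G_{[M]}$) are bijective additive maps with $T_g(am)=g(a)T_g(m)$ and $T_gT_h=\theta_M(g,h)T_{gh}$. Let $X$ be a finite $\mu_{\mathbb K}$-decorated $G$-set, $X_0\subseteq X$ a set of representatives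 of the $G$-orbits, and $A$ any split semisimple $G$-algebra (semisimple, with all simple modules absolutely simple) with $\mathrm{Irr}(A)\cong X$ as decorated $G$-sets, so that $\mathcal C^G(X)=A*G\text{-}\mathrm{Mod}$, the category of left modules over the skew group algebra ($ga=g(a)g$). For $x\in X_0$ let $\theta_x$ be any $2$-cocycle of $G_x$ representing $\pi_x^{-1}$, and let $G_x\text{-}\mathrm{Mod}_{\pi_x^{-1}}$ be the category of projective representations of $G_x$ with cocycle $\theta_x$, i.e. $\mathbb K$-vector spaces $V$ (of any dimension) with $\rho(g)\in\mathrm{GL}(V)$, $\rho(g)\rho(h)=\theta_x(g,h)\rho(gh)$. The monoidal category $G\text{-}\mathrm{Mod}$ of $\mathbb K$-linear representations of $G$ acts on the right on $A*G\text{-}\mathrm{Mod}$ by $M\boxtimes W=M\otimes_{\mathbb K}W$ with $(ag)(m\otimes w)=(agm)\otimes(gw)$, and on $G_x\text{-}\mathrm{Mod}_{\pi_x^{-1}}$ by $V\boxtimes W=V\otimes_{\mathbb K}W|_{G_x}$. Then $$\mathcal C^G(X)=A*G\text{-}\mathrm{Mod}\;\simeq\;\bigoplus_{x\in X_0}G_x\text{-}\mathrm{Mod}_{\pi_x^{-1}}$$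 as $\mathbb K$-linear right module categories over $G\text{-}\mathrm{Mod}$. -/

import Mathlib

open CategoryTheory

universe u v w

noncomputable section

namespace LabelDuality

/-! ### The functor `μ_K` -/

/-- The multiplicative group `Kˣ` (written additively) with trivial action of `H`. The base ring
is `ULift ℤ` only because group cohomology wants the ring and the group in one universe. -/
abbrev unitsRep (K : Type u) [Field K] (H : Type u) [Group H] : Rep (ULift.{u} ℤ) H :=
  Rep.trivial (ULift.{u} ℤ) H (Additive Kˣ)

/-- The `2`-cocycles of `H` with values in `Kˣ`, trivial action. -/
abbrev Cocycle (K : Type u) [Field K] (H : Type u) [Group H] : Type u :=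
  groupCohomology.cocycles₂ (unitsRep K H)

/-- The value `θ(g, h) ∈ Kˣ` of a `2`-cocycle. -/
def Cocycle.val {K : Type u} [Field K] {H : Type u} [Group H] (θ : Cocycle K H) (g h : H) : Kˣ :=
  Additive.toMul (θ.1 (g, h) : Additive Kˣ)

/-- `μ_K(H) = H²(H, Kˣ)`, an abelian group written additively. -/
abbrev Mu (K : Type u) [Field K] (H : Type u) [Group H] : Type u :=
  groupCohomology.H2 (unitsRep K H)

/-- The cohomology class of a cocycle. -/
def Cocycle.cls {K : Type u} [Field K] {H : Type u} [Group H] (θ : Cocycle K H) : Mu K H :=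
  groupCohomology.H2π (unitsRep K H) θ

/-- Contravariant functoriality of `μ_K`: pull-back along a group homomorphism. -/
def Mu.pullback (K : Type u) [Field K] {H H' : Type u} [Group H] [Group H'] (f : H →* H') :
    Mu K H' → Mu K H :=
  fun c => groupCohomology.map (A := unitsRep K H') (B := unitsRep K H) f
    (Rep.ofHom ⟨LinearMap.id, fun _ => rfl⟩) 2 c

/-! ### Decorated `G`-sets -/

/-- Conjugation `h ↦ g⁻¹ h g` from the stabiliser of `g • x` to the stabiliser of `x`. -/
def conjStab {G : Type u} [Group G] {X : Type w} [MulAction G X] (g : G) (x : X) :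
    MulAction.stabilizer G (g • x) →* MulAction.stabilizer G x where
  toFun h := ⟨g⁻¹ * h * g, by
    have := h.2
    rw [MulAction.mem_stabilizer_iff] at this ⊢
    rw [mul_smul, mul_smul, this, inv_smul_smul]⟩
  map_one' := by ext; simp
  map_mul' a b := by ext; simp [mul_assoc]

/-- A `μ_K`-decorated `G`-set: a `G`-set with an equivariant family of frills
`π_x ∈ μ_K(G_x)`. Finiteness is a separate condition. -/
structure DecoratedGSet (K G : Type u) [Field K] [Group G] where
  carrier : Type w
  [action : MulAction G carrier]
  frill : ∀ x : carrier, Mu K (MulAction.stabilizer G x)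
  frill_smul : ∀ (g : G) (x : carrier), frill (g • x) = Mu.pullback K (conjStab g x) (frill x)

attribute [instance] DecoratedGSet.action

/-- An equivariant map sends the stabiliser of `x` to the stabiliser of `f x`. -/
def stabMap {G : Type u} [Group G] {X : Type v} {Y : Type w} [MulAction G X] [MulAction G Y]
    (f : X → Y) (hf : ∀ (g : G) (x : X), f (g • x) = g • f x) (x : X) :
    MulAction.stabilizer G x →* MulAction.stabilizer G (f x) where
  toFun h := ⟨h, by
    have := h.2
    rw [MulAction.mem_stabilizer_iff] at this ⊢
    rw [← hf, this]⟩
  map_one' := rfl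
  map_mul' _ _ := rfl

/-- Isomorphisms of decorated `G`-sets: equivariant bijections that respect the frills. -/
structure DecoratedGSet.Iso {K G : Type u} [Field K] [Group G]
    (X : DecoratedGSet.{u, v} K G) (Y : DecoratedGSet.{u, w} K G) where
  toEquiv : X.carrier ≃ Y.carrier
  map_smul : ∀ (g : G) (x : X.carrier), toEquiv (g • x) = g • toEquiv x
  map_frill : ∀ x : X.carrier,
    X.frill x = Mu.pullback K (stabMap toEquiv map_smul x) (Y.frill (toEquiv x))

/-! ### `G`-algebras and the decorated `G`-set `Irr A`

A `G`-algebra over `K` is a `K`-algebra `A` with `[MulSemiringAction G A] [SMulCommClass G K A]`,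
an action of `G` by `K`-algebra automorphisms. -/

/-- A simple module with `End_A(M) = K`. -/
def IsAbsolutelySimple (K : Type u) {A : Type u} [Field K] [Ring A] [Algebra K A]
    (M : ModuleCat.{u} A) : Prop :=
  IsSimpleModule A M ∧ ∀ f : M →ₗ[A] M, ∃ c : K, ∀ m : M, f m = algebraMap K A c • m

/-- A semisimple algebra all of whose simple modules are absolutely simple. -/
def IsSplitSemisimple (K A : Type u) [Field K] [Ring A] [Algebra K A] : Prop :=
  IsSemisimpleRing A ∧ ∀ M : ModuleCat.{u} A, IsSimpleModule A M → IsAbsolutelySimple K M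

/-- The twist `M^{[g]}`: the same abelian group with `a ·^{[g]} m = g(a) m`. -/
abbrev twist {G A : Type u} [Group G] [Ring A] [MulSemiringAction G A] (g : G)
    (M : ModuleCat.{u} A) : ModuleCat.{u} A :=
  (ModuleCat.restrictScalars (MulSemiringAction.toRingHom G A g)).obj M

/-- `T` is an isomorphism of `A`-modules from `M` to `N^{[g]}`. -/
def IsSemi {G A : Type u} [Group G] [Ring A] [MulSemiringAction G A] (g : G)
    {M N : ModuleCat.{u} A} (T : M ≃+ N) : Prop :=
  ∀ (a : A) (m : M), T (a • m) = (g • a) • T m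

section IsSemi

variable {G A : Type u} [Group G] [Ring A] [MulSemiringAction G A]

theorem isSemi_one {M N : ModuleCat.{u} A} (e : M ≃ₗ[A] N) :
    IsSemi (1 : G) (e.toAddEquiv : M ≃+ N) := by
  intro a m
  simp

theorem IsSemi.trans {g h : G} {M N P : ModuleCat.{u} A} {T : M ≃+ N} {S : N ≃+ P}
    (hT : IsSemi g T) (hS : IsSemi h S) : IsSemi (h * g) (T.trans S) := by
  intro a m
  simp [hT a m, hS _ _, mul_smul]

theorem IsSemi.symm {g : G} {M N : ModuleCat.{u} A} {T : M ≃+ N} (hT : IsSemi g T) :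
    IsSemi g⁻¹ T.symm := by
  intro a m
  apply T.injective
  simp [hT _ _]

/-- The identity map from `M` to `M^{[g⁻¹]}`. -/
def toTwist (g : G) (M : ModuleCat.{u} A) : M ≃+ twist g⁻¹ M where
  toFun m := m
  invFun m := m
  left_inv _ := rfl
  right_inv _ := rfl
  map_add' _ _ := rfl

theorem isSemi_twist (g : G) (M : ModuleCat.{u} A) : IsSemi g (toTwist g M) := by
  intro a m
  change (a • m : M) = ((g⁻¹ • g • a) • m : M)
  rw [inv_smul_smul]

/-- A semilinear isomorphism for `1` is an isomorphism of modules. -/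
def IsSemi.toLinearEquiv {g : G} (hg : g = 1) {M N : ModuleCat.{u} A} {T : M ≃+ N}
    (hT : IsSemi g T) : M ≃ₗ[A] N :=
  { T with map_smul' := fun a m => by subst hg; simpa using hT a m }

end IsSemi

section

variable {K G A : Type u} [Field K] [Group G] [Ring A] [Algebra K A]
  [MulSemiringAction G A] [SMulCommClass G K A]

theorem IsSemi.map_scalar {g : G} {M N : ModuleCat.{u} A} {T : M ≃+ N} (hT : IsSemi g T)
    (c : K) (m : M) : T (algebraMap K A c • m) = algebraMap K A c • T m := by
  rw [hT, smul_algebraMap]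

theorem IsAbsolutelySimple.of_isSemi {g : G} {M N : ModuleCat.{u} A} {T : M ≃+ N}
    (hT : IsSemi g T) (hM : IsAbsolutelySimple K M) : IsAbsolutelySimple K N := by
  obtain ⟨h1, h2⟩ := hM
  refine ⟨?_, ?_⟩
  · rw [isSimpleModule_iff_toSpanSingleton_surjective] at h1 ⊢
    obtain ⟨h3, h4⟩ := h1
    refine ⟨T.symm.toEquiv.nontrivial, fun x hx y => ?_⟩
    obtain ⟨a, ha⟩ := h4 (T.symm x) (by simpa using hx) (T.symm y)
    refine ⟨g • a, ?_⟩
    simp only [LinearMap.toSpanSingleton_apply] at ha ⊢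
    apply T.symm.injective
    rw [← ha, hT.symm]
    simp
  · intro f
    obtain ⟨c, hc⟩ := h2
      { toFun := fun m => T.symm (f (T m))
        map_add' := fun a b => by simp
        map_smul' := fun a m => by
          simp only [hT a m, map_smul, RingHom.id_apply]
          rw [hT.symm]
          simp }
    refine ⟨c, fun n => ?_⟩
    have := hc (T.symm n)
    simp only [LinearMap.coe_mk, AddHom.coe_mk, AddEquiv.apply_symm_apply] at this
    apply T.symm.injective
    rw [this, hT.symm.map_scalar]

theorem IsAbsolutelySimple.scalar_inj {M : ModuleCat.{u} A} (_hM : IsAbsolutelySimple K M)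
    {c d : K} {m : M} (hm : m ≠ 0) (h : algebraMap K A c • m = algebraMap K A d • m) : c = d := by
  by_contra hcd
  have h1 : algebraMap K A (c - d) • m = 0 := by rw [map_sub, sub_smul, h, sub_self]
  have h2 : algebraMap K A (c - d)⁻¹ • algebraMap K A (c - d) • m = m := by
    rw [smul_smul, ← map_mul, inv_mul_cancel₀ (sub_ne_zero.2 hcd), map_one, one_smul]
  rw [h1, smul_zero] at h2
  exact hm h2.symm

/-- Two semilinear isomorphisms out of an absolutely simple module differ by a scalar. -/
theorem IsAbsolutelySimple.exists_unit {g : G} {M N : ModuleCat.{u} A}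
    (hM : IsAbsolutelySimple K M) {T S : M ≃+ N} (hT : IsSemi g T) (hS : IsSemi g S) :
    ∃ c : Kˣ, ∀ m, T m = algebraMap K A c • S m := by
  obtain ⟨c, hc⟩ := hM.2 ((hT.trans hS.symm).toLinearEquiv (inv_mul_cancel g)).toLinearMap
  have hc' : ∀ m, S.symm (T m) = algebraMap K A c • m := hc
  have hTS : ∀ m, T m = algebraMap K A c • S m := fun m => by
    rw [← hS.map_scalar, ← hc', AddEquiv.apply_symm_apply]
  have : c ≠ 0 := by
    rintro rfl
    have := hM.1.nontrivial
    obtain ⟨m, hm⟩ := exists_ne (0 : M)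
    have := hTS m
    rw [map_zero, zero_smul] at this
    exact hm (by simpa using this)
  exact ⟨Units.mk0 c this, hTS⟩

end

/-- `T_g : M → M`, for `g ∈ H`, are `g`-semilinear bijections with `T_g T_h = θ(g, h) T_{gh}`. Thus
`g ↦ T_g` lifts the homomorphism `H → PGL(M)`, and `θ` is the obstruction cocycle of this lift. -/
structure IsLift {K G A : Type u} [Field K] [Group G] [Ring A] [Algebra K A]
    [MulSemiringAction G A] (M : ModuleCat.{u} A) (H : Subgroup G)
    (T : H → (M ≃+ M)) (θ : Cocycle K H) : Prop where
  semi : ∀ g : H, IsSemi (g : G) (T g)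
  mul : ∀ (g h : H) (m : M), T g (T h m) = algebraMap K A (θ.val g h : K) • T (g * h) m

section

variable {K G A : Type u} [Field K] [Group G] [Ring A] [Algebra K A]
  [MulSemiringAction G A] [SMulCommClass G K A]

theorem IsAbsolutelySimple.exists_isLift {M : ModuleCat.{u} A} (hM : IsAbsolutelySimple K M)
    (H : Subgroup G) (hH : ∀ g ∈ H, ∃ T : M ≃+ M, IsSemi g T) :
    ∃ (T : H → (M ≃+ M)) (θ : Cocycle K H), IsLift M H T θ := by
  choose T hT using fun g : H => hH g g.2
  have key : ∀ g h : H, ∃ c : Kˣ, ∀ m, T g (T h m) = algebraMap K A c • T (g * h) m :=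
    fun g h => hM.exists_unit ((hT h).trans (hT g)) (hT (g * h))
  choose c hc using key
  have := hM.1.nontrivial
  obtain ⟨m, hm⟩ := exists_ne (0 : M)
  refine ⟨T, ⟨fun p => (Additive.ofMul (c p.1 p.2) : Additive Kˣ),
    (groupCohomology.mem_cocycles₂_iff _).2 fun g h j => ?_⟩, hT, fun g h m => hc g h m⟩
  have h1 : T g (T h (T j m)) =
      algebraMap K A (c g h * c (g * h) j : K) • T (g * h * j) m := by
    rw [hc, hc, smul_smul, map_mul]
  have h2 : T g (T h (T j m)) =
      algebraMap K A (c h j * c g (h * j) : K) • T (g * h * j) m := by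
    rw [hc h j, (hT g).map_scalar, hc, smul_smul, map_mul, mul_assoc g h j]
  have h3 := hM.scalar_inj (by simpa using hm) (h1.symm.trans h2)
  have h4 : c (g * h) j * c g h = c h j * c g (h * j) := by
    ext
    simpa [mul_comm] using h3
  exact congrArg Additive.ofMul h4

theorem IsLift.cls_eq {M N : ModuleCat.{u} A} (hM : IsAbsolutelySimple K M) {H : Subgroup G}
    {T S} {θ η : Cocycle K H} (hT : IsLift M H T θ) (hS : IsLift N H S η) (e : M ≃ₗ[A] N) :
    θ.cls = η.cls := by
  have := hM.1.nontrivial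
  obtain ⟨m, hm⟩ := exists_ne (0 : M)
  have key : ∀ g : H, ∃ c : Kˣ, ∀ m, T g m = algebraMap K A c • e.symm (S g (e m)) := by
    intro g
    have h := ((isSemi_one (G := G) e).trans (hS.semi g)).trans (isSemi_one (G := G) e.symm)
    rw [one_mul, mul_one] at h
    exact hM.exists_unit (hT.semi g) h
  choose c hc using key
  refine (groupCohomology.H2π_eq_iff θ η).2 ⟨fun g => Additive.ofMul (c g), ?_⟩
  funext p
  obtain ⟨g, h⟩ := p
  have h1 : T g (T h m) =
      algebraMap K A (c h * c g * η.val g h : K) • e.symm (S (g * h) (e m)) := by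
    rw [hc h m, (hT.semi g).map_scalar, hc g, LinearEquiv.apply_symm_apply, hS.mul, map_smul,
      smul_smul, smul_smul, map_mul, map_mul]
  have h2 : T g (T h m) =
      algebraMap K A (θ.val g h * c (g * h) : K) • e.symm (S (g * h) (e m)) := by
    rw [hT.mul, hc, smul_smul, map_mul]
  have h3 := hM.scalar_inj (by simpa using hm) (h1.symm.trans h2)
  have h4 : c h / c (g * h) * c g = θ.val g h / η.val g h := by
    rw [div_mul_eq_mul_div, div_eq_div_iff_mul_eq_mul]
    ext
    push_cast
    exact h3
  exact congrArg Additive.ofMul h4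

end

/-- Isomorphism of absolutely simple modules. -/
def irrSetoid (K A : Type u) [Field K] [Ring A] [Algebra K A] :
    Setoid {M : ModuleCat.{u} A // IsAbsolutelySimple K M} where
  r M N := Nonempty (M.1 ≃ₗ[A] N.1)
  iseqv := ⟨fun _ => ⟨.refl _ _⟩, fun ⟨e⟩ => ⟨e.symm⟩, fun ⟨e⟩ ⟨f⟩ => ⟨e.trans f⟩⟩

/-- The set of isomorphism classes of absolutely simple `A`-modules. -/
def IrrSet (K A : Type u) [Field K] [Ring A] [Algebra K A] : Type (u + 1) :=
  Quotient (irrSetoid K A)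

section

variable {K G A : Type u} [Field K] [Group G] [Ring A] [Algebra K A]
  [MulSemiringAction G A] [SMulCommClass G K A]

/-- The isomorphism class of an absolutely simple module. -/
def IrrSet.mk (M : ModuleCat.{u} A) (hM : IsAbsolutelySimple K M) : IrrSet K A :=
  Quotient.mk (irrSetoid K A) ⟨M, hM⟩

theorem IrrSet.mk_eq_mk {M N : ModuleCat.{u} A} {hM : IsAbsolutelySimple K M}
    {hN : IsAbsolutelySimple K N} : IrrSet.mk M hM = IrrSet.mk N hN ↔ Nonempty (M ≃ₗ[A] N) :=
  Quotient.eq (r := irrSetoid K A)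

set_option linter.unusedSectionVars false in
theorem IrrSet.mk_eq_of_isSemi {g : G} (hg : g = 1) {M N : ModuleCat.{u} A}
    {hM : IsAbsolutelySimple K M} {hN : IsAbsolutelySimple K N} {T : M ≃+ N} (hT : IsSemi g T) :
    IrrSet.mk M hM = IrrSet.mk N hN :=
  IrrSet.mk_eq_mk.2 ⟨hT.toLinearEquiv hg⟩

/-- `g • [M] = [M^{[g⁻¹]}]`. -/
instance IrrSet.action : MulAction G (IrrSet K A) where
  smul g := Quotient.lift (s := irrSetoid K A)
    (fun M => IrrSet.mk (twist g⁻¹ M.1) (M.2.of_isSemi (isSemi_twist g M.1)))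
    (fun M N ⟨e⟩ => IrrSet.mk_eq_of_isSemi (G := G) (g := g * (1 * g⁻¹)) (by simp)
      (((isSemi_twist g M.1).symm.trans (isSemi_one e)).trans (isSemi_twist g N.1)))
  one_smul := by
    rintro ⟨M⟩
    exact IrrSet.mk_eq_of_isSemi (inv_one (G := G)) (isSemi_twist (1 : G) M.1).symm
  mul_smul g h := by
    rintro ⟨M⟩
    exact IrrSet.mk_eq_of_isSemi (G := G) (g := g * (h * (g * h)⁻¹)) (by simp)
      (((isSemi_twist (g * h) M.1).symm.trans (isSemi_twist h M.1)).trans (isSemi_twist g _))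

theorem IrrSet.smul_mk (g : G) (M : ModuleCat.{u} A) (hM : IsAbsolutelySimple K M) :
    g • IrrSet.mk M hM = IrrSet.mk (twist g⁻¹ M) (hM.of_isSemi (isSemi_twist g M)) := rfl

theorem IrrSet.exists_isSemi {g : G} {M : ModuleCat.{u} A} {hM : IsAbsolutelySimple K M}
    (h : g • IrrSet.mk M hM = IrrSet.mk M hM) : ∃ T : M ≃+ M, IsSemi g T := by
  obtain ⟨e⟩ := IrrSet.mk_eq_mk.1 ((IrrSet.smul_mk g M hM).symm.trans h)
  have := (isSemi_twist g M).trans (isSemi_one (G := G) e)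
  rw [one_mul] at this
  exact ⟨_, this⟩

theorem IrrSet.existsUnique_frill (x : IrrSet K A) :
    ∃! c : Mu K (MulAction.stabilizer G x),
      ∃ (M : ModuleCat.{u} A) (hM : IsAbsolutelySimple K M)
        (T : MulAction.stabilizer G x → (M ≃+ M)) (θ : Cocycle K (MulAction.stabilizer G x)),
        x = IrrSet.mk M hM ∧ IsLift M _ T θ ∧ c = θ.cls := by
  obtain ⟨M, hM⟩ := x
  obtain ⟨T, θ, h⟩ := hM.exists_isLift (MulAction.stabilizer G (IrrSet.mk M hM))
    (fun g hg => IrrSet.exists_isSemi hg)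
  refine ⟨θ.cls, ⟨M, hM, T, θ, rfl, h, rfl⟩, ?_⟩
  rintro c ⟨N, hN, S, η, e, hS, rfl⟩
  obtain ⟨e⟩ := IrrSet.mk_eq_mk.1 e
  exact (h.cls_eq hM hS e).symm

/-- The frill `π_M = [θ_M]` of an absolutely simple module. -/
def IrrSet.frill (x : IrrSet K A) : Mu K (MulAction.stabilizer G x) :=
  (IrrSet.existsUnique_frill x).choose

theorem IrrSet.frill_eq {M : ModuleCat.{u} A} (hM : IsAbsolutelySimple K M) {T}
    {θ : Cocycle K (MulAction.stabilizer G (IrrSet.mk M hM))}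
    (h : IsLift M (MulAction.stabilizer G (IrrSet.mk M hM)) T θ) :
    IrrSet.frill (IrrSet.mk M hM) = θ.cls :=
  ((IrrSet.existsUnique_frill (G := G) (IrrSet.mk M hM)).choose_spec.2 _
    ⟨M, hM, T, θ, rfl, h, rfl⟩).symm

theorem Mu.pullback_cls {H H' : Type u} [Group H] [Group H'] (f : H →* H') (θ : Cocycle K H') :
    ∃ η : Cocycle K H, Mu.pullback K f θ.cls = η.cls ∧ ∀ g h, η.val g h = θ.val (f g) (f h) :=
  ⟨groupCohomology.mapCocycles₂ (A := unitsRep K H') (B := unitsRep K H) f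
    (Rep.ofHom ⟨LinearMap.id, fun _ => rfl⟩) θ,
    groupCohomology.H2π_comp_map_apply (A := unitsRep K H') (B := unitsRep K H) f
      (Rep.ofHom ⟨LinearMap.id, fun _ => rfl⟩) θ, fun _ _ => rfl⟩

theorem IsLift.toTwist {M : ModuleCat.{u} A} {H H' : Subgroup G} {T} {θ : Cocycle K H}
    (h : IsLift M H T θ) (g : G) (f : H' →* H) (hf : ∀ k, (f k : G) = g⁻¹ * k * g)
    (η : Cocycle K H') (hη : ∀ k l, η.val k l = θ.val (f k) (f l)) :
    IsLift (twist g⁻¹ M) H'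
      (fun k => ((LabelDuality.toTwist g M).symm.trans (T (f k))).trans (LabelDuality.toTwist g M))
      η where
  semi k := by
    have := ((isSemi_twist g M).symm.trans (h.semi (f k))).trans (isSemi_twist g M)
    have e : g * ((f k : G) * g⁻¹) = k := by rw [hf]; group
    rwa [e] at this
  mul k l m := by
    simp only [AddEquiv.trans_apply, AddEquiv.symm_apply_apply]
    rw [h.mul, (isSemi_twist g M).map_scalar, hη, map_mul]

theorem IrrSet.frill_smul (g : G) (x : IrrSet K A) :
    IrrSet.frill (g • x) = Mu.pullback K (conjStab g x) (IrrSet.frill x) := by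
  obtain ⟨M, hM⟩ := x
  obtain ⟨T, θ, h⟩ := hM.exists_isLift (MulAction.stabilizer G (IrrSet.mk M hM))
    (fun g hg => IrrSet.exists_isSemi hg)
  change IrrSet.frill (g • IrrSet.mk M hM) =
    Mu.pullback K (conjStab g (IrrSet.mk M hM)) (IrrSet.frill (IrrSet.mk M hM))
  rw [IrrSet.frill_eq hM h]
  obtain ⟨η, h1, h2⟩ := Mu.pullback_cls (conjStab g (IrrSet.mk M hM)) θ
  rw [h1]
  exact IrrSet.frill_eq (hM.of_isSemi (isSemi_twist g M))
    (h.toTwist g (conjStab g (IrrSet.mk M hM)) (fun _ => rfl) η h2)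

end

/-- The decorated `G`-set of isomorphism classes of absolutely simple modules of a `G`-algebra. -/
def Irr (K G A : Type u) [Field K] [Group G] [Ring A] [Algebra K A]
    [MulSemiringAction G A] [SMulCommClass G K A] : DecoratedGSet.{u, u + 1} K G where
  carrier := IrrSet K A
  frill := IrrSet.frill
  frill_smul := IrrSet.frill_smul

/-! ### Projective representations -/

/-- A projective representation of `H` with cocycle `θ`: a vector space `V` of any dimension and
maps `ρ(h) ∈ GL(V)` with `ρ(g) ρ(h) = θ(g, h) ρ(gh)`. -/
structure ProjRep {K H : Type u} [Field K] [Group H] (θ : Cocycle K H) where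
  V : Type u
  [addCommGroup : AddCommGroup V]
  [module : Module K V]
  ρ : H → (V ≃ₗ[K] V)
  ρ_mul : ∀ (g h : H) (v : V), ρ g (ρ h v) = (θ.val g h : K) • ρ (g * h) v

attribute [instance] ProjRep.addCommGroup ProjRep.module

namespace ProjRep

variable {K : Type u} [Field K]

section

variable {H : Type u} [Group H] {θ : Cocycle K H}

/-- The space of morphisms: linear maps that commute with all `ρ(h)`. -/
def homs (V W : ProjRep θ) : Submodule K (V.V →ₗ[K] W.V) where
  carrier := {f | ∀ (h : H) (v : V.V), f (V.ρ h v) = W.ρ h (f v)}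
  zero_mem' := fun h v => by simp
  add_mem' := fun {f g} hf hg h v => by simp [hf h v, hg h v]
  smul_mem' := fun c f hf h v => by simp [hf h v]

/-- The category `H-Mod_θ`. -/
instance : Category (ProjRep θ) where
  Hom V W := homs V W
  id V := ⟨LinearMap.id, fun _ _ => rfl⟩
  comp f g := ⟨g.1.comp f.1, fun h v => by
    rw [LinearMap.comp_apply, f.2 h v, g.2 h]; rfl⟩

/-- The linear map underlying a morphism. -/
def Hom.lin {V W : ProjRep θ} (f : V ⟶ W) : V.V →ₗ[K] W.V := Subtype.val f

/-- A morphism from an equivariant linear map. -/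
def Hom.mk {V W : ProjRep θ} (f : V.V →ₗ[K] W.V)
    (hf : ∀ (h : H) (v : V.V), f (V.ρ h v) = W.ρ h (f v)) : V ⟶ W := ⟨f, hf⟩

@[ext]
theorem hom_ext {V W : ProjRep θ} {f g : V ⟶ W} (h : Hom.lin f = Hom.lin g) : f = g :=
  Subtype.ext h

theorem Hom.comm {V W : ProjRep θ} (f : V ⟶ W) (h : H) (v : V.V) :
    Hom.lin f (V.ρ h v) = W.ρ h (Hom.lin f v) := f.2 h v

@[simp] theorem Hom.lin_mk {V W : ProjRep θ} (f : V.V →ₗ[K] W.V) (hf) :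
    Hom.lin (Hom.mk f hf : V ⟶ W) = f := rfl

@[simp] theorem Hom.lin_id (V : ProjRep θ) : Hom.lin (𝟙 V) = LinearMap.id := rfl

@[simp] theorem Hom.lin_comp {V W U : ProjRep θ} (f : V ⟶ W) (g : W ⟶ U) :
    Hom.lin (f ≫ g) = (Hom.lin g).comp (Hom.lin f) := rfl

instance : Preadditive (ProjRep θ) where
  homGroup V W := inferInstanceAs (AddCommGroup (homs V W))
  add_comp _ _ _ f f' g := hom_ext (LinearMap.comp_add (Hom.lin f) (Hom.lin f') (Hom.lin g))
  comp_add _ _ _ f g g' := hom_ext (LinearMap.add_comp (Hom.lin f) (Hom.lin g') (Hom.lin g))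

instance : Linear K (ProjRep θ) where
  homModule V W := inferInstanceAs (Module K (homs V W))
  smul_comp _ _ _ c f g := hom_ext (LinearMap.comp_smul (Hom.lin g) c (Hom.lin f))
  comp_smul _ _ _ f c g := hom_ext (LinearMap.smul_comp c (Hom.lin g) (Hom.lin f))

/-- An isomorphism from an equivariant linear equivalence. -/
def isoMk {V W : ProjRep θ} (e : V.V ≃ₗ[K] W.V)
    (he : ∀ (h : H) (v : V.V), e (V.ρ h v) = W.ρ h (e v)) : V ≅ W where
  hom := Hom.mk e.toLinearMap he
  inv := Hom.mk e.symm.toLinearMap fun h w => by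
    apply e.injective
    simp [he]
  hom_inv_id := hom_ext (by ext; simp)
  inv_hom_id := hom_ext (by ext; simp)

@[simp] theorem isoMk_hom {V W : ProjRep θ} (e : V.V ≃ₗ[K] W.V) (he) :
    Hom.lin (isoMk e he : V ≅ W).hom = e.toLinearMap := rfl

@[simp] theorem isoMk_inv {V W : ProjRep θ} (e : V.V ≃ₗ[K] W.V) (he) :
    Hom.lin (isoMk e he : V ≅ W).inv = e.symm.toLinearMap := rfl

end

/-- The invertible operator of a group element in a representation. -/
def repEquiv {G : Type u} [Group G] (W : Rep.{u} K G) (g : G) : W.V ≃ₗ[K] W.V :=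
  LinearEquiv.ofLinearMap (W.ρ g) (W.ρ g⁻¹) (by ext; simp) (by ext; simp)

@[simp] theorem repEquiv_apply {G : Type u} [Group G] (W : Rep.{u} K G) (g : G) (w : W.V) :
    repEquiv W g w = W.ρ g w := rfl

variable {G : Type u} [Group G] {H : Subgroup G} {θ : Cocycle K H}

/-- The projective representation `V ⊗ W` of a subgroup `H` of `G`, for a projective
representation `V` of `H` and a representation `W` of `G`. -/
def tensor (V : ProjRep θ) (W : Rep.{u} K G) : ProjRep θ where
  V := TensorProduct K V.V W.V
  ρ h := TensorProduct.congr (V.ρ h) (repEquiv W (h : G))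
  ρ_mul g h t := by
    induction t with
    | zero => simp
    | tmul v w => simp [V.ρ_mul, TensorProduct.smul_tmul']
    | add x y hx hy => simp only [map_add, smul_add, hx, hy]

theorem tensor_comm {V U : ProjRep θ} {W : Rep.{u} K G}
    (φ : TensorProduct K V.V W.V →ₗ[K] U.V)
    (hφ : ∀ (h : H) (v : V.V) (w : W.V),
      φ (V.ρ h v ⊗ₜ[K] W.ρ (h : G) w) = U.ρ h (φ (v ⊗ₜ[K] w)))
    (h : H) (t : (tensor V W).V) : φ ((tensor V W).ρ h t) = U.ρ h (φ t) := by
  have : φ ∘ₗ (TensorProduct.congr (V.ρ h) (repEquiv W (h : G))).toLinearMap =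
      (U.ρ h).toLinearMap ∘ₗ φ := TensorProduct.ext' fun v w => hφ h v w
  exact LinearMap.congr_fun this t

theorem tensor_comm₂ {V U : ProjRep θ} {W W' : Rep.{u} K G}
    (φ : TensorProduct K V.V (TensorProduct K W.V W'.V) →ₗ[K] U.V)
    (hφ : ∀ (h : H) (v : V.V) (w : W.V) (w' : W'.V),
      φ (V.ρ h v ⊗ₜ[K] (W.ρ (h : G) w ⊗ₜ[K] W'.ρ (h : G) w')) =
        U.ρ h (φ (v ⊗ₜ[K] (w ⊗ₜ[K] w'))))
    (h : H) (t : (tensor V (MonoidalCategoryStruct.tensorObj W W')).V) :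
    φ ((tensor V (MonoidalCategoryStruct.tensorObj W W')).ρ h t) = U.ρ h (φ t) := by
  have : φ ∘ₗ (TensorProduct.congr (V.ρ h)
      (TensorProduct.congr (repEquiv W (h : G)) (repEquiv W' (h : G)))).toLinearMap =
      (U.ρ h).toLinearMap ∘ₗ φ := TensorProduct.ext (LinearMap.ext fun v =>
        TensorProduct.ext' fun w w' => hφ h v w w')
  exact LinearMap.congr_fun this t

theorem tensor_hom_ext {V U : ProjRep θ} {W : Rep.{u} K G} {f g : tensor V W ⟶ U}
    (h : ∀ (v : V.V) (w : W.V), Hom.lin f (v ⊗ₜ[K] w : TensorProduct K V.V W.V) =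
      Hom.lin g (v ⊗ₜ[K] w : TensorProduct K V.V W.V)) : f = g :=
  hom_ext (TensorProduct.ext' h)

theorem tensor_hom_ext₂ {V U : ProjRep θ} {W W' : Rep.{u} K G}
    {f g : tensor V (MonoidalCategoryStruct.tensorObj W W') ⟶ U}
    (h : ∀ (v : V.V) (w : W.V) (w' : W'.V),
      Hom.lin f (v ⊗ₜ[K] (w ⊗ₜ[K] w') : TensorProduct K V.V (TensorProduct K W.V W'.V)) =
      Hom.lin g (v ⊗ₜ[K] (w ⊗ₜ[K] w') : TensorProduct K V.V (TensorProduct K W.V W'.V))) :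
    f = g := by
  refine hom_ext ?_
  refine TensorProduct.ext (M := V.V) (N := TensorProduct K W.V W'.V) ?_
  refine LinearMap.ext fun v => TensorProduct.ext' fun w w' => h v w w'

/-- `H-Mod_θ` is a right module category over `G-Mod`, for a subgroup `H` of `G`. -/
instance : MonoidalCategory.MonoidalRightAction (Rep.{u} K G) (ProjRep θ) where
  actionObj V W := tensor V W
  actionHomLeft {V V'} f W := Hom.mk (LinearMap.rTensor W.V (Hom.lin f))
    (tensor_comm (U := tensor V' W) _ fun h v w =>
      congrArg (fun x => x ⊗ₜ[K] W.ρ (h : G) w) (Hom.comm f h v))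
  actionHomRight V {W W'} f := Hom.mk (LinearMap.lTensor V.V f.hom.toLinearMap)
    (tensor_comm (U := tensor V W') _ fun h v w =>
      congrArg (fun x => V.ρ h v ⊗ₜ[K] x) (Rep.hom_comm_apply f (h : G) w))
  actionHom {W W' V V'} f g := Hom.mk (TensorProduct.map (Hom.lin f) g.hom.toLinearMap)
    (tensor_comm (U := tensor V' W') _ fun h v w =>
      congrArg₂ (fun x y => x ⊗ₜ[K] y) (Hom.comm f h v) (Rep.hom_comm_apply g (h : G) w))
  actionAssocIso V W W' := isoMk (TensorProduct.assoc K V.V W.V W'.V).symm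
    (tensor_comm₂ (U := tensor (tensor V W) W')
      (TensorProduct.assoc K V.V W.V W'.V).symm.toLinearMap fun _ _ _ _ => rfl)
  actionUnitIso V := isoMk (TensorProduct.rid K V.V)
    (tensor_comm (W := MonoidalCategoryStruct.tensorUnit _) (U := V)
      (TensorProduct.rid K V.V).toLinearMap fun h v w => ((V.ρ h).map_smul w v).symm)
  actionHom_def f g := tensor_hom_ext fun _ _ => rfl
  actionHomRight_id V W := tensor_hom_ext fun _ _ => rfl
  id_actionHomLeft V W := tensor_hom_ext fun _ _ => rfl
  actionHom_comp f f' g g' := tensor_hom_ext fun _ _ => rfl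
  actionAssocIso_hom_naturality f g h := tensor_hom_ext₂ fun _ _ _ => rfl
  actionUnitIso_hom_naturality f := tensor_hom_ext fun v w => (Hom.lin f).map_smul w v
  actionHomRight_whiskerRight f W V := tensor_hom_ext₂ fun _ _ _ => rfl
  whiskerRight_actionHomLeft W _ _ f V := tensor_hom_ext₂ fun _ _ _ => rfl
  actionHom_associator W₁ W₂ W₃ V := by
    refine hom_ext ?_
    refine TensorProduct.ext (M := V.V)
      (N := TensorProduct K (TensorProduct K W₁.V W₂.V) W₃.V) ?_
    exact LinearMap.ext fun v => TensorProduct.ext_threefold fun _ _ _ => rfl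
  actionHom_leftUnitor W V := tensor_hom_ext₂ fun v c w => (TensorProduct.smul_tmul c v w).symm
  actionHom_rightUnitor W V := tensor_hom_ext₂ fun v w c => (TensorProduct.tmul_smul c v w)

end ProjRep

/-! ### Direct sums of module categories -/

section DirectSum

variable {ι : Type w} (C : ι → Type u) [∀ i, Category.{v} (C i)]

/-- Componentwise. -/
instance [∀ i, Preadditive (C i)] : Preadditive (∀ i, C i) where
  homGroup X Y := inferInstanceAs (AddCommGroup (∀ i, X i ⟶ Y i))
  add_comp _ _ _ f f' g := funext fun i => Preadditive.add_comp _ _ _ (f i) (f' i) (g i)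
  comp_add _ _ _ f g g' := funext fun i => Preadditive.comp_add _ _ _ (f i) (g i) (g' i)

/-- Componentwise. -/
instance (K : Type*) [Semiring K] [∀ i, Preadditive (C i)] [∀ i, Linear K (C i)] :
    Linear K (∀ i, C i) where
  homModule X Y := inferInstanceAs (Module K (∀ i, X i ⟶ Y i))
  smul_comp _ _ _ c f g := funext fun i => Linear.smul_comp _ _ _ c (f i) (g i)
  comp_smul _ _ _ f c g := funext fun i => Linear.comp_smul _ _ _ (f i) c (g i)

open MonoidalCategory MonoidalRightAction in
/-- The direct sum of a finite family of module categories is the product category, with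
componentwise action. -/
instance (D : Type*) [Category D] [MonoidalCategory D] [∀ i, MonoidalRightAction D (C i)] :
    MonoidalRightAction D (∀ i, C i) where
  actionObj X d := fun i => X i ⊙ᵣ d
  actionHomLeft f d := fun i => f i ⊵ᵣ d
  actionHomRight X _ _ f := fun i => X i ⊴ᵣ f
  actionHom f g := fun i => f i ⊙ᵣₘ g
  actionAssocIso X d d' := Pi.isoMk fun i => αᵣ (X i) d d'
  actionUnitIso X := Pi.isoMk fun i => ρᵣ (X i)
  actionHom_def _ _ := funext fun _ => MonoidalRightAction.actionHom_def _ _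
  actionHomRight_id _ _ := funext fun _ => MonoidalRightAction.actionHomRight_id _ _
  id_actionHomLeft _ _ := funext fun _ => MonoidalRightAction.id_actionHomLeft _ _
  actionHom_comp _ _ _ _ := funext fun _ => MonoidalRightAction.actionHom_comp _ _ _ _
  actionAssocIso_hom_naturality _ _ _ :=
    funext fun _ => MonoidalRightAction.actionAssocIso_hom_naturality _ _ _
  actionUnitIso_hom_naturality _ :=
    funext fun _ => MonoidalRightAction.actionUnitIso_hom_naturality _
  actionHomRight_whiskerRight _ _ _ :=
    funext fun _ => MonoidalRightAction.actionHomRight_whiskerRight _ _ _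
  whiskerRight_actionHomLeft _ _ _ _ _ :=
    funext fun _ => MonoidalRightAction.whiskerRight_actionHomLeft _ _ _
  actionHom_associator _ _ _ _ := funext fun _ => MonoidalRightAction.actionHom_associator _ _ _ _
  actionHom_leftUnitor _ _ := funext fun _ => MonoidalRightAction.actionHom_leftUnitor _ _
  actionHom_rightUnitor _ _ := funext fun _ => MonoidalRightAction.actionHom_rightUnitor _ _

end DirectSum

/-! ### Modules over the skew group algebra

The skew group algebra `A * G` is `SkewMonoidAlgebra A G`, with `g a = g(a) g`. -/

namespace SkewModule

open scoped ModuleCat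

variable {K G A : Type u} [Field K] [Group G] [Ring A] [Algebra K A]
  [MulSemiringAction G A] [SMulCommClass G K A]

/-- The action of `A` on the first factor and the diagonal action of `G`:
`(a g) (m ⊗ w) = (a g m) ⊗ (g w)`. -/
def tensorAct (M : ModuleCat.{u} (SkewMonoidAlgebra A G)) (W : Rep.{u} K G) :
    SkewMonoidAlgebra A G →+* Module.End K (TensorProduct K M W.V) :=
  SkewMonoidAlgebra.liftNCRingHom
    (((Module.End.rTensorAlgHom K M W.V).comp
      (Algebra.lsmul K K M)).toRingHom.comp
        (SkewMonoidAlgebra.singleOneRingHom : A →+* SkewMonoidAlgebra A G))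
    (Representation.tprod
      ((Algebra.lsmul K K M).toMonoidHom.comp (SkewMonoidAlgebra.of A G)) W.ρ)
    (by
      intro a g
      refine TensorProduct.ext' fun m w => ?_
      change ((SkewMonoidAlgebra.single 1 (g • a) : SkewMonoidAlgebra A G) •
          (SkewMonoidAlgebra.single g (1 : A) : SkewMonoidAlgebra A G) • m) ⊗ₜ[K] W.ρ g w =
        ((SkewMonoidAlgebra.single g (1 : A) : SkewMonoidAlgebra A G) •
          (SkewMonoidAlgebra.single 1 a : SkewMonoidAlgebra A G) • m) ⊗ₜ[K] W.ρ g w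
      simp [smul_smul, SkewMonoidAlgebra.single_mul_single])

/-- The abelian group `M ⊗_K W`, for an `A * G`-module `M` and a `G`-module `W`. -/
def Tensor (M : ModuleCat.{u} (SkewMonoidAlgebra A G)) (W : Rep.{u} K G) : Type u :=
  TensorProduct K M W.V

instance (M : ModuleCat.{u} (SkewMonoidAlgebra A G)) (W : Rep.{u} K G) :
    AddCommGroup (Tensor M W) :=
  inferInstanceAs (AddCommGroup (TensorProduct K M W.V))

instance (M : ModuleCat.{u} (SkewMonoidAlgebra A G)) (W : Rep.{u} K G) :
    Module (SkewMonoidAlgebra A G) (Tensor M W) :=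
  Module.compHom (TensorProduct K M W.V) (tensorAct M W)

/-- The `A * G`-module `M ⊠ W`. -/
def tensor (M : ModuleCat.{u} (SkewMonoidAlgebra A G)) (W : Rep.{u} K G) :
    ModuleCat.{u} (SkewMonoidAlgebra A G) :=
  ModuleCat.of (SkewMonoidAlgebra A G) (Tensor M W)

/-- The pure tensor `m ⊗ w` in `M ⊠ W`. -/
def tmul (M : ModuleCat.{u} (SkewMonoidAlgebra A G)) (W : Rep.{u} K G) (m : M) (w : W.V) :
    tensor M W :=
  (m ⊗ₜ[K] w : TensorProduct K M W.V)

theorem tensorAct_single (M : ModuleCat.{u} (SkewMonoidAlgebra A G)) (W : Rep.{u} K G)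
    (g : G) (a : A) :
    tensorAct M W (SkewMonoidAlgebra.single g a) =
      LinearMap.rTensor W.V
          (Algebra.lsmul K K M (SkewMonoidAlgebra.single 1 a : SkewMonoidAlgebra A G)) *
        TensorProduct.map
          (Algebra.lsmul K K M (SkewMonoidAlgebra.single g (1 : A) : SkewMonoidAlgebra A G))
          (W.ρ g) :=
  SkewMonoidAlgebra.liftNC_single _ _ g a

theorem single_smul_tmul {M : ModuleCat.{u} (SkewMonoidAlgebra A G)} {W : Rep.{u} K G}
    (g : G) (a : A) (m : M) (w : W.V) :
    (SkewMonoidAlgebra.single g a : SkewMonoidAlgebra A G) • tmul M W m w =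
      tmul M W ((SkewMonoidAlgebra.single g a : SkewMonoidAlgebra A G) • m) (W.ρ g w) := by
  change tensorAct M W (SkewMonoidAlgebra.single g a) (m ⊗ₜ[K] w) = _
  rw [tensorAct_single]
  change (((SkewMonoidAlgebra.single 1 a : SkewMonoidAlgebra A G) •
          (SkewMonoidAlgebra.single g (1 : A) : SkewMonoidAlgebra A G) • m) ⊗ₜ[K] W.ρ g w
            : TensorProduct K M W.V) =
        ((SkewMonoidAlgebra.single g a : SkewMonoidAlgebra A G) • m) ⊗ₜ[K] W.ρ g w
  simp [smul_smul, SkewMonoidAlgebra.single_mul_single]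

theorem tmul_induction {M : ModuleCat.{u} (SkewMonoidAlgebra A G)} {W : Rep.{u} K G}
    {p : tensor M W → Prop} (t : tensor M W) (zero : p 0) (tmul : ∀ m w, p (tmul M W m w))
    (add : ∀ x y, p x → p y → p (x + y)) : p t :=
  TensorProduct.induction_on (R := K) (M := M) (N := W.V) (motive := p) t zero tmul add

/-- The underlying abelian group of `M ⊠ W` is `M ⊗_K W`. -/
def tensorAddEquiv (M : ModuleCat.{u} (SkewMonoidAlgebra A G)) (W : Rep.{u} K G) :
    TensorProduct K M W.V ≃+ tensor M W where
  toFun t := t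
  invFun t := t
  left_inv _ := rfl
  right_inv _ := rfl
  map_add' _ _ := rfl

/-- The underlying vector space of `M ⊠ W` is `M ⊗_K W`. -/
def tensorEquiv (M : ModuleCat.{u} (SkewMonoidAlgebra A G)) (W : Rep.{u} K G) :
    TensorProduct K M W.V ≃ₗ[K] tensor M W :=
  AddEquiv.toLinearEquiv (tensorAddEquiv M W) (by
      intro c t
      induction t using TensorProduct.induction_on with
      | zero => rw [smul_zero, map_zero, smul_zero]
      | add x y hx hy => rw [smul_add, map_add, map_add, smul_add, hx, hy]
      | tmul m w =>
        change tmul M W (c • m) w = (algebraMap K (SkewMonoidAlgebra A G) c) • tmul M W m w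
        rw [SkewMonoidAlgebra.coe_algebraMap, Function.comp_apply, single_smul_tmul, map_one]
        rfl)

theorem map_smul_of {M N : ModuleCat.{u} (SkewMonoidAlgebra A G)} {W : Rep.{u} K G}
    (φ : tensor M W →+ N)
    (h : ∀ (g : G) (a : A) (m : M) (w : W.V),
      φ (tmul M W ((SkewMonoidAlgebra.single g a : SkewMonoidAlgebra A G) • m) (W.ρ g w)) =
        (SkewMonoidAlgebra.single g a : SkewMonoidAlgebra A G) • φ (tmul M W m w))
    (r : SkewMonoidAlgebra A G) (t : tensor M W) : φ (r • t) = r • φ t := by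
  induction r using SkewMonoidAlgebra.induction_on with
  | zero => simp
  | add r s hr hs => rw [add_smul, map_add, hr, hs, add_smul]
  | single g a =>
    induction t using tmul_induction with
    | zero => simp
    | tmul m w => rw [single_smul_tmul, h]
    | add x y hx hy => rw [smul_add, map_add, hx, hy, map_add, smul_add]

theorem tensor_ind₂ {M : Type u} [AddCommGroup M] [Module K M] {W W' : Type u} [AddCommGroup W]
    [Module K W] [AddCommGroup W'] [Module K W'] {N : Type u} [AddCommGroup N]
    (φ ψ : TensorProduct K M (TensorProduct K W W') →+ N)
    (h : ∀ m w w', φ (m ⊗ₜ (w ⊗ₜ w')) = ψ (m ⊗ₜ (w ⊗ₜ w'))) : φ = ψ := by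
  ext t
  induction t using TensorProduct.induction_on with
  | zero => simp
  | add x y hx hy => rw [map_add, hx, hy, map_add]
  | tmul m t =>
    induction t using TensorProduct.induction_on with
    | zero => simp
    | tmul w w' => exact h m w w'
    | add x y hx hy => rw [TensorProduct.tmul_add, map_add, hx, hy, map_add]

theorem tensor_ind₃ {M : Type u} [AddCommGroup M] [Module K M] {W W' W'' : Type u}
    [AddCommGroup W] [Module K W] [AddCommGroup W'] [Module K W'] [AddCommGroup W''] [Module K W'']
    {N : Type u} [AddCommGroup N]
    (φ ψ : TensorProduct K M (TensorProduct K (TensorProduct K W W') W'') →+ N)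
    (h : ∀ m w w' w'', φ (m ⊗ₜ (w ⊗ₜ w' ⊗ₜ w'')) = ψ (m ⊗ₜ (w ⊗ₜ w' ⊗ₜ w''))) : φ = ψ := by
  refine tensor_ind₂ φ ψ fun m t w'' => ?_
  induction t using TensorProduct.induction_on with
  | zero => simp
  | tmul w w' => exact h m w w' w''
  | add x y hx hy =>
    rw [TensorProduct.add_tmul, TensorProduct.tmul_add, map_add, hx, hy, map_add]

/-- A morphism out of `M ⊠ W` from an equivariant linear map out of `M ⊗_K W`. -/
def homMk {M N : ModuleCat.{u} (SkewMonoidAlgebra A G)} {W : Rep.{u} K G}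
    (φ : TensorProduct K M W.V →ₗ[K] N)
    (h : ∀ (g : G) (a : A) (m : M) (w : W.V),
      φ (((SkewMonoidAlgebra.single g a : SkewMonoidAlgebra A G) • m) ⊗ₜ[K] W.ρ g w) =
        (SkewMonoidAlgebra.single g a : SkewMonoidAlgebra A G) • φ (m ⊗ₜ[K] w)) :
    tensor M W ⟶ N :=
  ModuleCat.ofHom
    { toFun := fun t => φ ((tensorEquiv M W).symm t)
      map_add' := fun x y => map_add (φ.comp (tensorEquiv M W).symm.toLinearMap) x y
      map_smul' := map_smul_of (φ.comp (tensorEquiv M W).symm.toLinearMap).toAddMonoidHom h }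

/-- An isomorphism out of `M ⊠ W` from an equivariant linear equivalence out of `M ⊗_K W`. -/
def isoMk {M N : ModuleCat.{u} (SkewMonoidAlgebra A G)} {W : Rep.{u} K G}
    (φ : TensorProduct K M W.V ≃ₗ[K] N)
    (h : ∀ (g : G) (a : A) (m : M) (w : W.V),
      φ (((SkewMonoidAlgebra.single g a : SkewMonoidAlgebra A G) • m) ⊗ₜ[K] W.ρ g w) =
        (SkewMonoidAlgebra.single g a : SkewMonoidAlgebra A G) • φ (m ⊗ₜ[K] w)) :
    tensor M W ≅ N :=
  LinearEquiv.toModuleIso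
    { (tensorEquiv M W).symm.trans φ with
      map_smul' := map_smul_of ((tensorEquiv M W).symm.trans φ).toAddEquiv.toAddMonoidHom h }

theorem hom_ext {M N : ModuleCat.{u} (SkewMonoidAlgebra A G)} {W : Rep.{u} K G}
    {f f' : tensor M W ⟶ N} (h : ∀ m w, f (tmul M W m w) = f' (tmul M W m w)) : f = f' := by
  ext t
  induction t using tmul_induction with
  | zero => simp
  | tmul m w => exact h m w
  | add x y hx hy => rw [map_add, hx, hy, map_add]

theorem hom_ext₂ {M N : ModuleCat.{u} (SkewMonoidAlgebra A G)} {W W' : Rep.{u} K G}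
    {f f' : tensor M (MonoidalCategoryStruct.tensorObj W W') ⟶ N}
    (h : ∀ m w w', f (tmul M (MonoidalCategoryStruct.tensorObj W W') m
        (w ⊗ₜ[K] w' : TensorProduct K W.V W'.V)) =
      f' (tmul M (MonoidalCategoryStruct.tensorObj W W') m
        (w ⊗ₜ[K] w' : TensorProduct K W.V W'.V))) : f = f' := by
  have := tensor_ind₂ (K := K) (M := M) (W := W.V) (W' := W'.V)
    (f.hom.toAddMonoidHom.comp (tensorAddEquiv M (MonoidalCategoryStruct.tensorObj W W')).toAddMonoidHom)
    (f'.hom.toAddMonoidHom.comp (tensorAddEquiv M (MonoidalCategoryStruct.tensorObj W W')).toAddMonoidHom) h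
  exact hom_ext fun m t => DFunLike.congr_fun this (m ⊗ₜ[K] t)

theorem hom_ext₃ {M N : ModuleCat.{u} (SkewMonoidAlgebra A G)} {W W' W'' : Rep.{u} K G}
    {f f' : tensor M (MonoidalCategoryStruct.tensorObj
      (MonoidalCategoryStruct.tensorObj W W') W'') ⟶ N}
    (h : ∀ m w w' w'', f (tmul M (MonoidalCategoryStruct.tensorObj
        (MonoidalCategoryStruct.tensorObj W W') W'') m
        (w ⊗ₜ[K] w' ⊗ₜ[K] w'' : TensorProduct K (TensorProduct K W.V W'.V) W''.V)) =
      f' (tmul M (MonoidalCategoryStruct.tensorObj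
        (MonoidalCategoryStruct.tensorObj W W') W'') m
        (w ⊗ₜ[K] w' ⊗ₜ[K] w'' : TensorProduct K (TensorProduct K W.V W'.V) W''.V))) :
    f = f' := by
  have := tensor_ind₃ (K := K) (M := M) (W := W.V) (W' := W'.V) (W'' := W''.V)
    (f.hom.toAddMonoidHom.comp (tensorAddEquiv M
      (MonoidalCategoryStruct.tensorObj (MonoidalCategoryStruct.tensorObj W W') W'')).toAddMonoidHom)
    (f'.hom.toAddMonoidHom.comp (tensorAddEquiv M
      (MonoidalCategoryStruct.tensorObj (MonoidalCategoryStruct.tensorObj W W') W'')).toAddMonoidHom) h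
  exact hom_ext fun m t => DFunLike.congr_fun this (m ⊗ₜ[K] t)

theorem single_smul_assoc {M : ModuleCat.{u} (SkewMonoidAlgebra A G)} {W W' : Rep.{u} K G}
    (g : G) (a : A) (m : M) (w : W.V) (w' : W'.V) :
    (SkewMonoidAlgebra.single g a : SkewMonoidAlgebra A G) •
        tmul (tensor M W) W' (tmul M W m w) w' =
      tmul (tensor M W) W'
        (tmul M W ((SkewMonoidAlgebra.single g a : SkewMonoidAlgebra A G) • m) (W.ρ g w))
        (W'.ρ g w') := by
  rw [single_smul_tmul, single_smul_tmul]

theorem assoc_comm (M : ModuleCat.{u} (SkewMonoidAlgebra A G)) (W W' : Rep.{u} K G) (g : G)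
    (a : A) (m : M) (t : TensorProduct K W.V W'.V) :
    ((TensorProduct.assoc K M W.V W'.V).symm ≪≫ₗ
        (TensorProduct.congr (tensorEquiv M W) (LinearEquiv.refl K W'.V) ≪≫ₗ
          tensorEquiv (tensor M W) W'))
      (((SkewMonoidAlgebra.single g a : SkewMonoidAlgebra A G) • m) ⊗ₜ[K]
        TensorProduct.map (W.ρ g) (W'.ρ g) t) =
    (SkewMonoidAlgebra.single g a : SkewMonoidAlgebra A G) •
      ((TensorProduct.assoc K M W.V W'.V).symm ≪≫ₗ
        (TensorProduct.congr (tensorEquiv M W) (LinearEquiv.refl K W'.V) ≪≫ₗ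
          tensorEquiv (tensor M W) W')) (m ⊗ₜ[K] t) := by
  induction t using TensorProduct.induction_on with
  | zero => simp
  | add x y hx hy =>
    rw [map_add, TensorProduct.tmul_add, map_add, hx, hy, TensorProduct.tmul_add, map_add, smul_add]
  | tmul w w' => exact (single_smul_assoc g a m w w').symm

/-- `A * G-Mod` is a right module category over `G-Mod`. -/
instance : MonoidalCategory.MonoidalRightAction (Rep.{u} K G)
    (ModuleCat.{u} (SkewMonoidAlgebra A G)) where
  actionObj M W := tensor M W
  actionHomLeft {M M'} f W :=
    homMk ((tensorEquiv M' W).toLinearMap ∘ₗ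
      LinearMap.rTensor W.V (f.hom.restrictScalars K)) fun g a m w =>
        (congrArg (fun x => tmul M' W x (W.ρ g w)) (f.hom.map_smul _ m)).trans
          (single_smul_tmul (M := M') (W := W) g a (f m) w).symm
  actionHomRight M {W W'} f :=
    homMk ((tensorEquiv M W').toLinearMap ∘ₗ
      LinearMap.lTensor M f.hom.toLinearMap) fun g a m w =>
        (congrArg (fun x => tmul M W'
            ((SkewMonoidAlgebra.single g a : SkewMonoidAlgebra A G) • m) x)
          (Rep.hom_comm_apply f g w)).trans
          (single_smul_tmul (M := M) (W := W') g a m (f.hom w)).symm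
  actionHom {W W' M M'} f h :=
    homMk ((tensorEquiv M' W').toLinearMap ∘ₗ
      TensorProduct.map (f.hom.restrictScalars K) h.hom.toLinearMap) fun g a m w =>
        (congrArg₂ (fun x y => tmul M' W' x y) (f.hom.map_smul _ m)
          (Rep.hom_comm_apply h g w)).trans
          (single_smul_tmul (M := M') (W := W') g a (f m) (h.hom w)).symm
  actionAssocIso M W W' :=
    isoMk (W := MonoidalCategoryStruct.tensorObj W W')
      ((TensorProduct.assoc K M W.V W'.V).symm ≪≫ₗ
        (TensorProduct.congr (tensorEquiv M W) (LinearEquiv.refl K W'.V) ≪≫ₗ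
          tensorEquiv (tensor M W) W')) (assoc_comm M W W')
  actionUnitIso M :=
    isoMk (W := MonoidalCategoryStruct.tensorUnit _) (TensorProduct.rid K M) fun g a m c => by
        change (c : K) • (SkewMonoidAlgebra.single g a : SkewMonoidAlgebra A G) • m =
          (SkewMonoidAlgebra.single g a : SkewMonoidAlgebra A G) • (c : K) • m
        rw [smul_comm]
  actionHom_def f g := hom_ext fun _ _ => rfl
  actionHomRight_id V W := hom_ext fun _ _ => rfl
  id_actionHomLeft V W := hom_ext fun _ _ => rfl
  actionHom_comp f f' g g' := hom_ext fun _ _ => rfl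
  actionAssocIso_hom_naturality f g h := hom_ext₂ fun _ _ _ => rfl
  actionUnitIso_hom_naturality f := hom_ext fun m c => (f.hom.restrictScalars K).map_smul c m
  actionHomRight_whiskerRight f W V := hom_ext₂ fun _ _ _ => rfl
  whiskerRight_actionHomLeft W _ _ f V := hom_ext₂ fun _ _ _ => rfl
  actionHom_associator W₁ W₂ W₃ M := by
    refine hom_ext₃ fun _ _ _ _ => rfl
  actionHom_leftUnitor W M := hom_ext₂ fun m c w =>
    congrArg (tensorEquiv M W) (TensorProduct.smul_tmul (c : K) m w).symm
  actionHom_rightUnitor W M := hom_ext₂ fun m w c =>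
    (congrArg (tensorEquiv M W) (TensorProduct.tmul_smul (c : K) m w)).trans
      ((tensorEquiv M W).map_smul (c : K) (m ⊗ₜ[K] w))

end SkewModule

/-- The category `A * G-Mod` of all left modules over the skew group algebra of a `G`-algebra `A`,
that is, the category of `G`-equivariant coherent sheaves on any decorated `G`-set `X ≅ Irr A`. -/
abbrev EquivariantSheaves (G A : Type u) [Group G] [Ring A] [MulSemiringAction G A] :
    Type (u + 1) :=
  ModuleCat.{u} (SkewMonoidAlgebra A G)

/-- Equivalence of `K`-linear right module categories over `D`: a `K`-linear module functor that is
an equivalence of categories. -/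
def ModuleCategoryEquivalent (K : Type*) [Field K] (D : Type*) [Category D] [MonoidalCategory D]
    (C C' : Type*) [Category C] [Category C'] [Preadditive C] [Preadditive C'] [Linear K C]
    [Linear K C'] [MonoidalCategory.MonoidalRightAction D C]
    [MonoidalCategory.MonoidalRightAction D C'] : Prop :=
  ∃ F : C ⥤ C', F.IsEquivalence ∧ F.Additive ∧ F.Linear K ∧ Nonempty (F.RightLinear D)

end LabelDuality

end

/-! For each representative `x` let `S_x` be an absolutely simple `A`-module in the class
corresponding to `x`. Since `θ x` represents the inverse of the frill, the semilinear operators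
`T_g` on `S_x`, `g ∈ G_x`, can be rescaled so that their obstruction cocycle is exactly the inverse
of `θ x` (`IsLift.exists_liftedSimple`). Then `g` acts on `Hom_A(S_x, M)` by `f ↦ g ∘ f ∘ T_g⁻¹`,
with cocycle `θ x`, and the equivalence is `M ↦ (Hom_A(S_x, M))_x`, the functor `homsFunctor`.

It is a module functor because `Hom_A(S, M) ⊗ W → Hom_A(S, M ⊗ W)` is bijective: a homomorphism out
of a simple module is determined by its value at one nonzero vector, and that value involves only
finitely many basis vectors of `W` (`intertwinersTensor_bijective`).

That it is an equivalence rests on two properties of the family: distinct `S_x` are not twists of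
one another and only elements of `G_x` fix the class of `S_x` (`IsSeparated`); every simple module
is a twist of some `S_x` (`IsExhaustive`). Choose `s ≠ 0` in `S_x` and an `A`-linear `σ : S_x → A`
with `σ(s) s = s`. The element `e = σ(s)` is idempotent, and `e n` is the value at `s` of the
homomorphism `t ↦ σ(t) n`. Exhaustiveness makes these idempotents, applied to all of `(A * G) n`,
detect whether `n = 0` (`IsExhaustive.eq_zero`), which gives faithfulness. For fullness, maps `ψ_x`
on the Hom spaces generate a submodule of `M × N`; separation shows that the idempotents see in it
only the graphs of the `ψ_x` (`graphSpan_spec`), so it is itself the graph of a homomorphism. For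
essential surjectivity, `S_x ⊗ V_x` is an honest `G_x`-module, the two cocycles cancelling;
coinducing it to `G` and applying Schur's lemma returns `V_x` (`IsSeparated.coindHom_bijective`). -/

noncomputable section

namespace LabelDuality

set_option linter.unusedSectionVars false

open scoped ModuleCat TensorProduct

/-! ### Intertwiners out of a simple module, and tensor products -/

section HomSpaces

variable {K A : Type u} [Field K] [Ring A] [Algebra K A]

/-- The `K`-linear maps `f : S → M` with `f (a s) = α a (f s)`, where `α` gives the operators of
`A` on `M`. -/
def intertwiners (S : ModuleCat.{u} A) {M : Type u} [AddCommGroup M] [Module K M]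
    (α : A → M →ₗ[K] M) : Submodule K (S →ₗ[K] M) where
  carrier := {f | ∀ (a : A) (s : S), f (a • s) = α a (f s)}
  zero_mem' := fun a s => by simp
  add_mem' := fun {f g} hf hg a s => by simp [hf a s, hg a s]
  smul_mem' := fun c f hf a s => by simp [hf a s]

variable {S : ModuleCat.{u} A} {M : Type u} [AddCommGroup M] [Module K M] {α : A → M →ₗ[K] M}

theorem intertwiners_map (f : intertwiners S α) (a : A) (s : S) :
    f.1 (a • s) = α a (f.1 s) := f.2 a s

/-- A vector of a simple module generates it. -/
theorem exists_smul_eq_of_simple (hS : IsSimpleModule A S) {s : S} (hs : s ≠ 0) (t : S) :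
    ∃ a : A, a • s = t :=
  (isSimpleModule_iff_toSpanSingleton_surjective.1 hS).2 s hs t

/-- An intertwiner out of a simple module is determined by its value at a nonzero vector. -/
theorem intertwiners_ext (hS : IsSimpleModule A S) {s : S} (hs : s ≠ 0) {f g : intertwiners S α}
    (h : f.1 s = g.1 s) : f = g := by
  refine Subtype.ext (LinearMap.ext fun t => ?_)
  obtain ⟨a, rfl⟩ := exists_smul_eq_of_simple hS hs t
  rw [f.2, g.2, h]

variable {N W : Type u} [AddCommGroup N] [Module K N] [AddCommGroup W] [Module K W]
  {β : A → N →ₗ[K] N}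

/-- The comparison map `Hom_A(S, M) ⊗ W → Hom_A(S, M ⊗ W)`, where `N` is identified with
`M ⊗ W`. -/
def intertwinersTensor (S : ModuleCat.{u} A) (e : (M ⊗[K] W) ≃ₗ[K] N)
    (he : ∀ a t, e (LinearMap.rTensor W (α a) t) = β a (e t)) :
    intertwiners S α ⊗[K] W →ₗ[K] intertwiners S β :=
  TensorProduct.lift
    (LinearMap.mk₂ K (fun f w =>
      (⟨e.toLinearMap ∘ₗ (TensorProduct.mk K M W).flip w ∘ₗ f.1, fun a s => by
        have := he a (f.1 s ⊗ₜ w)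
        simp only [LinearMap.rTensor_tmul] at this
        simp [f.2 a s, this]⟩ : intertwiners S β))
      (fun f g w => Subtype.ext (LinearMap.ext fun s => by simp))
      (fun c f w => Subtype.ext (LinearMap.ext fun s => by simp))
      (fun f v w => Subtype.ext (LinearMap.ext fun s => by simp))
      (fun c f w => Subtype.ext (LinearMap.ext fun s => by simp)))

theorem intertwinersTensor_tmul (e : (M ⊗[K] W) ≃ₗ[K] N)
    (he : ∀ a t, e (LinearMap.rTensor W (α a) t) = β a (e t)) (f : intertwiners S α) (w : W)
    (s : S) : (intertwinersTensor S e he (f ⊗ₜ w)).1 s = e (f.1 s ⊗ₜ w) := rfl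

/-- Evaluation at a nonzero vector `s` is injective on intertwiners. Tensoring with `W` keeps it
injective; conversely, an intertwiner into `M ⊗ W` splits into coordinates along a basis of `W`, and
those with value zero at `s` vanish identically. -/
theorem intertwinersTensor_bijective (hS : IsSimpleModule A S) (e : (M ⊗[K] W) ≃ₗ[K] N)
    (he : ∀ a t, e (LinearMap.rTensor W (α a) t) = β a (e t)) :
    Function.Bijective (intertwinersTensor S e he) := by
  have := hS.nontrivial
  classical
  obtain ⟨s, hs⟩ := exists_ne (0 : S)
  let ev : intertwiners S α →ₗ[K] M := LinearMap.applyₗ s ∘ₗ (intertwiners S α).subtype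
  have hev : Function.Injective ev := fun f g h => intertwiners_ext hS hs h
  constructor
  · have h1 : Function.Injective (e.toLinearMap ∘ₗ LinearMap.rTensor W ev) :=
      e.injective.comp (Module.Flat.rTensor_preserves_injective_linearMap ev hev)
    have h2 : ∀ t, (e.toLinearMap ∘ₗ LinearMap.rTensor W ev) t =
        (intertwinersTensor S e he t).1 s := by
      intro t
      induction t with
      | zero => simp
      | tmul f w => rfl
      | add x y hx hy => rw [map_add, hx, hy, map_add]; rfl
    intro x y hxy
    apply h1
    rw [h2, h2, hxy]
  · intro F
    let b := Module.Basis.ofVectorSpace K W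
    let E := TensorProduct.equivFinsuppOfBasisRight (M := M) b
    have hE : ∀ (φ : M →ₗ[K] M) t i, E (LinearMap.rTensor W φ t) i = φ (E t i) := by
      intro φ t i
      induction t with
      | zero => simp
      | tmul m w => simp [E]
      | add x y hx hy => simp only [map_add, Finsupp.add_apply, hx, hy]
    -- The coordinates of `F` along the basis of `W` are again intertwiners, since `A` acts on `M`
    -- only.
    let f : ∀ _ : _, intertwiners S α := fun i =>
      ⟨Finsupp.lapply i ∘ₗ E.toLinearMap ∘ₗ e.symm.toLinearMap ∘ₗ F.1, fun a s => by
        have h3 : e.symm (β a (F.1 s)) = LinearMap.rTensor W (α a) (e.symm (F.1 s)) := by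
          apply e.injective
          rw [he]
          simp
        simp [F.2 a s, h3, hE]⟩
    -- The finite support of the single vector `F s` suffices, because equality needs to be checked
    -- only at `s`.
    refine ⟨∑ i ∈ (E (e.symm (F.1 s))).support, f i ⊗ₜ b i, intertwiners_ext hS hs ?_⟩
    apply e.symm.injective
    apply E.injective
    rw [map_sum]
    simp only [AddSubmonoidClass.coe_finsetSum, LinearMap.sum_apply, intertwinersTensor_tmul,
      map_sum, LinearEquiv.symm_apply_apply]
    conv_rhs => rw [← Finsupp.sum_single (E (e.symm (F.1 s)))]
    refine Finset.sum_congr rfl fun i _ => ?_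
    ext j
    simp [E, f, Finsupp.single_apply]

end HomSpaces

/-! ### Module functors from invertible lax structures -/

section RightLinearOfIsIso

open MonoidalCategory MonoidalRightAction Functor

variable {C D D' : Type*} [Category* C] [MonoidalCategory C] [Category* D] [Category* D']
  [MonoidalRightAction C D] [MonoidalRightAction C D']

/-- A lax module functor with invertible structure morphisms is a module functor. -/
abbrev rightLinearOfIsIso (F : D ⥤ D') [F.LaxRightLinear C]
    [∀ d (c : C), IsIso (LaxRightLinear.μᵣ F d c)] : F.RightLinear C where
  δᵣ d c := inv (LaxRightLinear.μᵣ F d c)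
  δᵣ_naturality_right d c c' f := by
    rw [IsIso.comp_inv_eq, Category.assoc, LaxRightLinear.μᵣ_naturality_right,
      IsIso.inv_hom_id_assoc]
  δᵣ_naturality_left f c := by
    rw [IsIso.comp_inv_eq, Category.assoc, LaxRightLinear.μᵣ_naturality_left,
      IsIso.inv_hom_id_assoc]
  δᵣ_associativity d c c' := by
    rw [IsIso.inv_comp_eq, ← inv_actionHomLeft, ← Category.assoc, ← Category.assoc,
      IsIso.eq_comp_inv, IsIso.eq_comp_inv, Category.assoc, LaxRightLinear.μᵣ_associativity]
  δᵣ_unitality_inv d := by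
    rw [IsIso.eq_comp_inv, LaxRightLinear.μᵣ_unitality_inv]
  μᵣ_comp_δᵣ d c := IsIso.hom_inv_id _
  δᵣ_comp_μᵣ d c := IsIso.inv_hom_id _

end RightLinearOfIsIso

/-! ### Operators of `A` and `G` on modules over the skew group algebra -/

variable {K G A : Type u} [Field K] [Group G] [Ring A] [Algebra K A]
  [MulSemiringAction G A] [SMulCommClass G K A]

/-- The action of `a ∈ A` on an `A * G`-module. -/
def algOp (M : ModuleCat.{u} (SkewMonoidAlgebra A G)) (a : A) : M →ₗ[K] M :=
  Algebra.lsmul K K M (SkewMonoidAlgebra.single 1 a : SkewMonoidAlgebra A G)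

/-- The action of `g ∈ G` on an `A * G`-module. -/
def grpOp (M : ModuleCat.{u} (SkewMonoidAlgebra A G)) (g : G) : M →ₗ[K] M :=
  Algebra.lsmul K K M (SkewMonoidAlgebra.single g 1 : SkewMonoidAlgebra A G)

section Ops

variable {M N : ModuleCat.{u} (SkewMonoidAlgebra A G)}

theorem algOp_apply (a : A) (m : M) :
    algOp (K := K) M a m = (SkewMonoidAlgebra.single 1 a : SkewMonoidAlgebra A G) • m := rfl

theorem grpOp_apply (g : G) (m : M) :
    grpOp (K := K) M g m = (SkewMonoidAlgebra.single g 1 : SkewMonoidAlgebra A G) • m := rfl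

theorem single_smul_eq (g : G) (a : A) (m : M) :
    (SkewMonoidAlgebra.single g a : SkewMonoidAlgebra A G) • m =
      algOp (K := K) M a (grpOp (K := K) M g m) := by
  rw [algOp_apply, grpOp_apply, smul_smul, SkewMonoidAlgebra.single_mul_single]
  simp

theorem algOp_mul (a b : A) (m : M) :
    algOp (K := K) M (a * b) m = algOp (K := K) M a (algOp (K := K) M b m) := by
  simp [algOp_apply, smul_smul, SkewMonoidAlgebra.single_mul_single]

theorem algOp_add (a b : A) (m : M) :
    algOp (K := K) M (a + b) m = algOp (K := K) M a m + algOp (K := K) M b m := by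
  rw [algOp_apply, SkewMonoidAlgebra.single_add, add_smul, algOp_apply, algOp_apply]

theorem grpOp_mul (g h : G) (m : M) :
    grpOp (K := K) M (g * h) m = grpOp (K := K) M g (grpOp (K := K) M h m) := by
  simp [grpOp_apply, smul_smul, SkewMonoidAlgebra.single_mul_single]

theorem grpOp_one (m : M) : grpOp (K := K) M (1 : G) m = m := by
  rw [grpOp_apply, SkewMonoidAlgebra.single_one_one, one_smul]

theorem grpOp_inv_grpOp (g : G) (m : M) :
    grpOp (K := K) M g⁻¹ (grpOp (K := K) M g m) = m := by
  rw [← grpOp_mul, inv_mul_cancel, grpOp_one]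

theorem grpOp_grpOp_inv (g : G) (m : M) :
    grpOp (K := K) M g (grpOp (K := K) M g⁻¹ m) = m := by
  rw [← grpOp_mul, mul_inv_cancel, grpOp_one]

theorem grpOp_algOp (g : G) (a : A) (m : M) :
    grpOp (K := K) M g (algOp (K := K) M a m) =
      algOp (K := K) M (g • a) (grpOp (K := K) M g m) := by
  simp [algOp_apply, grpOp_apply, smul_smul, SkewMonoidAlgebra.single_mul_single]

theorem smul_eq_algOp (c : K) (m : M) : c • m = algOp (K := K) M (algebraMap K A c) m := rfl

theorem map_algOp (φ : M ⟶ N) (a : A) (m : M) :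
    φ (algOp (K := K) M a m) = algOp (K := K) N a (φ m) := φ.hom.map_smul _ _

theorem map_grpOp (φ : M ⟶ N) (g : G) (m : M) :
    φ (grpOp (K := K) M g m) = grpOp (K := K) N g (φ m) := φ.hom.map_smul _ _

end Ops

/-! ### The Hom functor of one lifted simple module -/

/-- An absolutely simple `A`-module `S` with a lift `T` of the homomorphism `H → PGL(S)` whose
obstruction cocycle is the inverse of `θ`. -/
structure LiftedSimple (A : Type u) [Ring A] [Algebra K A] [MulSemiringAction G A]
    {H : Subgroup G} (θ : Cocycle K H) where
  S : ModuleCat.{u} A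
  absSimple : IsAbsolutelySimple K S
  T : H → (S ≃+ S)
  semi : ∀ g : H, IsSemi (g : G) (T g)
  mul : ∀ (g h : H) (s : S), algebraMap K A (θ.val g h : K) • T g (T h s) = T (g * h) s

namespace LiftedSimple

variable {H : Subgroup G} {θ : Cocycle K H} (D : LiftedSimple A θ)

/-- The semilinear map `T g` as a `K`-linear map. -/
def lin (g : H) : D.S ≃ₗ[K] D.S :=
  { D.T g with map_smul' := fun c s => (D.semi g).map_scalar c s }

theorem lin_smul (g : H) (a : A) (s : D.S) : D.lin g (a • s) = ((g : G) • a) • D.lin g s :=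
  D.semi g a s

theorem lin_mul (g h : H) (s : D.S) :
    (θ.val g h : K) • D.lin g (D.lin h s) = D.lin (g * h) s := D.mul g h s

theorem lin_symm_smul (g : H) (a : A) (s : D.S) :
    (D.lin g).symm (a • s) = ((g : G)⁻¹ • a) • (D.lin g).symm s := by
  apply (D.lin g).injective
  rw [lin_smul]
  simp

/-- Inverting the operators inverts their cocycle. This is where `f ↦ g ∘ f ∘ T_g⁻¹` acquires the
cocycle `θ`. -/
theorem lin_symm_mul (g h : H) (s : D.S) :
    (D.lin h).symm ((D.lin g).symm s) = (θ.val g h : K) • (D.lin (g * h)).symm s := by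
  apply (D.lin h).injective
  apply (D.lin g).injective
  apply (smul_right_injective D.S (θ.val g h).ne_zero)
  simp only [LinearEquiv.apply_symm_apply, map_smul]
  rw [D.lin_mul]
  simp

/-- The space `Hom_A(S, M)`. -/
abbrev homs (M : ModuleCat.{u} (SkewMonoidAlgebra A G)) : Submodule K (D.S →ₗ[K] M) :=
  intertwiners D.S (algOp M)

/-- `f ↦ g ∘ f ∘ T_g⁻¹`. -/
def conj (M : ModuleCat.{u} (SkewMonoidAlgebra A G)) (g : H) : D.homs M ≃ₗ[K] D.homs M where
  toFun f := ⟨grpOp M (g : G) ∘ₗ f.1 ∘ₗ (D.lin g).symm.toLinearMap, fun a s => by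
    simp [lin_symm_smul, intertwiners_map, grpOp_algOp]⟩
  invFun f := ⟨grpOp M (g : G)⁻¹ ∘ₗ f.1 ∘ₗ (D.lin g).toLinearMap, fun a s => by
    simp [lin_smul, intertwiners_map, grpOp_algOp]⟩
  left_inv f := Subtype.ext (LinearMap.ext fun s => by simp [grpOp_inv_grpOp])
  right_inv f := Subtype.ext (LinearMap.ext fun s => by simp [grpOp_grpOp_inv])
  map_add' f f' := Subtype.ext (LinearMap.ext fun s => by simp)
  map_smul' c f := Subtype.ext (LinearMap.ext fun s => by simp)

theorem conj_apply {M : ModuleCat.{u} (SkewMonoidAlgebra A G)} (g : H) (f : D.homs M) (s : D.S) :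
    (D.conj M g f).1 s = grpOp (K := K) M (g : G) (f.1 ((D.lin g).symm s)) := rfl

/-- The projective representation `Hom_A(S, M)` of `H`. -/
def homRep (M : ModuleCat.{u} (SkewMonoidAlgebra A G)) : ProjRep θ where
  V := D.homs M
  ρ := D.conj M
  ρ_mul g h f := Subtype.ext (LinearMap.ext fun s => by
    simp [conj_apply, lin_symm_mul, grpOp_mul])

/-- `f ↦ φ ∘ f`. -/
def homMap {M N : ModuleCat.{u} (SkewMonoidAlgebra A G)} (φ : M ⟶ N) :
    D.homs M →ₗ[K] D.homs N where
  toFun f := ⟨φ.hom.restrictScalars K ∘ₗ f.1, fun a s => by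
    change φ (f.1 (a • s)) = _
    rw [f.2, map_algOp]
    rfl⟩
  map_add' f f' := Subtype.ext (LinearMap.ext fun s => φ.hom.map_add _ _)
  map_smul' c f := Subtype.ext (LinearMap.ext fun s => (φ.hom.restrictScalars K).map_smul c _)

/-- The functor `M ↦ Hom_A(S, M)`. -/
def homFunctor : ModuleCat.{u} (SkewMonoidAlgebra A G) ⥤ ProjRep θ where
  obj M := D.homRep M
  map {M N} φ := ProjRep.Hom.mk (V := D.homRep M) (W := D.homRep N) (D.homMap φ) fun h _ =>
    Subtype.ext (LinearMap.ext fun _ => map_grpOp (K := K) φ (h : G) _)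
  map_id _ := rfl
  map_comp _ _ := rfl

/-- The comparison isomorphism `Hom_A(S, M) ⊗ W ≃ Hom_A(S, M ⊠ W)`. -/
def homTensor (M : ModuleCat.{u} (SkewMonoidAlgebra A G)) (W : Rep.{u} K G) :
    (D.homs M ⊗[K] W.V) ≃ₗ[K] D.homs (SkewModule.tensor M W) :=
  LinearEquiv.ofBijective
    (intertwinersTensor (β := algOp (SkewModule.tensor M W)) D.S (SkewModule.tensorEquiv M W)
      fun a t => by
        induction t with
        | zero => simp
        | add x y hx hy => simp only [map_add, hx, hy]
        | tmul m w =>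
          have := SkewModule.single_smul_tmul (M := M) (W := W) 1 a m w
          rw [map_one] at this
          exact this.symm)
    (intertwinersTensor_bijective D.absSimple.1 _ _)

/-- `G` acts diagonally on `M ⊠ W`, while `T_h⁻¹` touches only the argument of the homomorphism. -/
theorem homTensor_comm (M : ModuleCat.{u} (SkewMonoidAlgebra A G)) (W : Rep.{u} K G) (h : H)
    (f : D.homs M) (w : W.V) :
    D.homTensor M W (D.conj M h f ⊗ₜ W.ρ (h : G) w) =
      D.conj (SkewModule.tensor M W) h (D.homTensor M W (f ⊗ₜ w)) :=
  Subtype.ext (LinearMap.ext fun s => (SkewModule.single_smul_tmul (M := M) (W := W)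
    (h : G) 1 (f.1 ((D.lin h).symm s)) w).symm)

/-- The comparison isomorphism as an isomorphism of projective representations. -/
def homTensorIso (M : ModuleCat.{u} (SkewMonoidAlgebra A G)) (W : Rep.{u} K G) :
    ProjRep.tensor (D.homRep M) W ≅ D.homRep (SkewModule.tensor M W) :=
  ProjRep.isoMk (V := ProjRep.tensor (D.homRep M) W) (D.homTensor M W)
    (ProjRep.tensor_comm (V := D.homRep M) (U := D.homRep (SkewModule.tensor M W))
      (D.homTensor M W).toLinearMap (D.homTensor_comm M W))

instance : D.homFunctor.LaxRightLinear (Rep.{u} K G) where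
  μᵣ M W := (D.homTensorIso M W).hom
  μᵣ_naturality_right _ _ _ _ := ProjRep.tensor_hom_ext fun _ _ => rfl
  μᵣ_naturality_left _ _ := ProjRep.tensor_hom_ext fun _ _ => rfl
  μᵣ_associativity _ _ _ := ProjRep.tensor_hom_ext₂ fun _ _ _ => rfl
  μᵣ_unitality _ := ProjRep.tensor_hom_ext fun _ _ => rfl

end LiftedSimple

/-! ### The Hom functor of a family -/

section Family

variable {ι : Type w} {H : ι → Subgroup G} {θ : ∀ i, Cocycle K (H i)}
  (D : ∀ i, LiftedSimple A (θ i))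

/-- The functor `M ↦ (Hom_A(S_i, M))_i`. -/
def homsFunctor : ModuleCat.{u} (SkewMonoidAlgebra A G) ⥤ ∀ i, ProjRep (θ i) where
  obj M i := (D i).homFunctor.obj M
  map φ i := (D i).homFunctor.map φ
  map_id _ := rfl
  map_comp _ _ := rfl

instance : (homsFunctor D).Additive where
  map_add {_ _ _ _} := funext fun _ => rfl

instance : (homsFunctor D).Linear K where
  map_smul φ c := funext fun i => by
    refine ProjRep.hom_ext (LinearMap.ext fun f => Subtype.ext (LinearMap.ext fun s => rfl))

open Functor in
instance : (homsFunctor D).LaxRightLinear (Rep.{u} K G) where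
  μᵣ M W i := ((D i).homTensorIso M W).hom
  μᵣ_naturality_right M _ _ f := funext fun i =>
    LaxRightLinear.μᵣ_naturality_right (D i).homFunctor M f
  μᵣ_naturality_left f W := funext fun i =>
    LaxRightLinear.μᵣ_naturality_left (D i).homFunctor f W
  μᵣ_associativity M W W' := funext fun i =>
    LaxRightLinear.μᵣ_associativity (D i).homFunctor M W W'
  μᵣ_unitality M := funext fun i => LaxRightLinear.μᵣ_unitality (D i).homFunctor M

instance (M : ModuleCat.{u} (SkewMonoidAlgebra A G)) (W : Rep.{u} K G) :
    IsIso (Functor.LaxRightLinear.μᵣ (homsFunctor D) M W) :=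
  (Pi.isoMk fun i => (D i).homTensorIso M W).isIso_hom

end Family

/-! ### Local idempotents and semilinear Schur lemma -/

/-- A nonzero vector `s` of a simple module is fixed by `σ s` for some `A`-linear `σ : S → A`. -/
theorem exists_linearMap_smul_self [IsSemisimpleRing A] {S : ModuleCat.{u} A}
    (hS : IsSimpleModule A S) {s : S} (hs : s ≠ 0) : ∃ σ : S →ₗ[A] A, σ s • s = s := by
  have : Module.Projective A S := Module.projective_of_isSemisimpleRing A S
  -- `σ` is a section of the surjection `a ↦ a s` from `A` to the projective module `S`.
  obtain ⟨σ, hσ⟩ := Module.projective_lifting_property (LinearMap.toSpanSingleton A S s)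
    LinearMap.id ((isSimpleModule_iff_toSpanSingleton_surjective.1 hS).2 s hs)
  exact ⟨σ, LinearMap.congr_fun hσ s⟩

/-- Schur's lemma for semilinear maps. -/
theorem semilinear_eq_zero_or_isSemi {S S' : ModuleCat.{u} A} (hS : IsAbsolutelySimple K S)
    (hS' : IsAbsolutelySimple K S') {g : G} (F : S →+ S')
    (hF : ∀ (a : A) (s : S), F (a • s) = (g • a) • F s) :
    F = 0 ∨ ∃ T : S ≃+ S', IsSemi g T := by
  have h0 : IsAbsolutelySimple K (twist g⁻¹⁻¹ S') := hS'.of_isSemi (isSemi_twist g⁻¹ S')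
  rw [inv_inv] at h0
  have := hS.1
  have := h0.1
  -- Semilinear maps into `S'` are linear maps into its twist, so the usual Schur lemma applies.
  let F' : S →ₗ[A] twist g S' := { F with map_smul' := hF }
  by_cases h : F' = 0
  · exact Or.inl (AddMonoidHom.ext fun s => LinearMap.congr_fun h s)
  · exact Or.inr ⟨AddEquiv.ofBijective F (LinearMap.bijective_of_ne_zero h), hF⟩

/-! ### Separation, exhaustiveness, faithfulness and fullness -/

section Family

variable {ι : Type w} {H : ι → Subgroup G} {θ : ∀ i, Cocycle K (H i)}
  (D : ∀ i, LiftedSimple A (θ i))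

/-- The modules `S_i` lie in different `G`-orbits, and `H_i` is the stabiliser of `S_i`. -/
def IsSeparated : Prop :=
  ∀ (i j : ι) (g : G), (∃ T : (D i).S ≃+ (D j).S, IsSemi g T) → i = j ∧ g ∈ H i

/-- The modules `S_i` meet all `G`-orbits of simple modules. -/
def IsExhaustive : Prop :=
  ∀ L : ModuleCat.{u} A, IsSimpleModule A L →
    ∃ (i : ι) (g : G) (T : (D i).S ≃+ L), IsSemi g T

variable {D}

theorem IsSeparated.eq_zero (hD : IsSeparated D) {i j : ι} {g : G} (h : ¬ (i = j ∧ g ∈ H i))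
    (F : (D i).S →+ (D j).S) (hF : ∀ (a : A) (s : (D i).S), F (a • s) = (g • a) • F s) : F = 0 :=
  (semilinear_eq_zero_or_isSemi (D i).absSimple (D j).absSimple F hF).resolve_right
    fun hT => h (hD i j g hT)

/-- If `n ≠ 0`, then `A n` contains a simple submodule `L`, the image of some `S_i` under a
`g`-semilinear `T`. The vector `q = T(s_i)` is fixed by `g(e_i)`, where `e_i = σ_i(s_i)`, so `e_i`
fixes `g⁻¹ q ≠ 0`, and `g⁻¹ q` lies in `(A * G) n`. -/
theorem IsExhaustive.eq_zero [IsSemisimpleRing A] (hD : IsExhaustive D) {s : ∀ i, (D i).S}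
    (hs : ∀ i, s i ≠ 0) {σ : ∀ i, (D i).S →ₗ[A] A} (hσ : ∀ i, σ i (s i) • s i = s i)
    {N : ModuleCat.{u} (SkewMonoidAlgebra A G)} {n : N}
    (hn : ∀ i (r : SkewMonoidAlgebra A G), algOp (K := K) N (σ i (s i)) (r • n) = 0) : n = 0 := by
  by_contra hne
  let N' : ModuleCat.{u} A := (ModuleCat.restrictScalars
    (SkewMonoidAlgebra.singleOneRingHom : A →+* SkewMonoidAlgebra A G)).obj N
  let n' : N' := n
  have hspan : Submodule.span A {n'} ≠ ⊥ := by
    rw [Ne, Submodule.span_singleton_eq_bot]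
    exact hne
  obtain ⟨L, hL, hLn⟩ := (eq_bot_or_exists_atom_le (Submodule.span A {n'})).resolve_left hspan
  have hLs : IsSimpleModule A L := isSimpleModule_iff_isAtom.2 hL
  obtain ⟨i, g, T, hT⟩ := hD (ModuleCat.of A L) hLs
  obtain ⟨a, ha⟩ := Submodule.mem_span_singleton.1 (hLn (T (s i) : L).2)
  -- As `T(s_i) = a n`, this multiplier sends `n` to `g⁻¹ T(s_i)`.
  have h1 := hn i (SkewMonoidAlgebra.single g⁻¹ 1 * SkewMonoidAlgebra.single 1 a)
  rw [mul_smul, ← grpOp_apply (K := K), ← algOp_apply (K := K)] at h1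
  obtain ⟨q, hq⟩ : ∃ q : N, q = ((T (s i) : L) : N') := ⟨_, rfl⟩
  have h2 : algOp (K := K) N a n = q := ha.trans hq.symm
  have h3 : σ i (s i) = g⁻¹ • g • σ i (s i) := by simp
  have h4 : algOp (K := K) N (g • σ i (s i)) q = q := by
    have := hT (σ i (s i)) (s i)
    rw [hσ] at this
    rw [hq]
    exact congrArg (fun x : L => (x : N')) this.symm
  rw [h2, h3, ← grpOp_algOp, h4] at h1
  have h5 : q = 0 := by
    rw [← grpOp_grpOp_inv (K := K) g q, h1, map_zero]
  have h6 : T (s i) = 0 := Subtype.ext (hq.symm.trans h5)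
  exact hs i (by simpa using h6)

/-- The homomorphism `t ↦ σ(t) n`. -/
def LiftedSimple.homOfLinear {H : Subgroup G} {θ : Cocycle K H} (D : LiftedSimple A θ)
    (σ : D.S →ₗ[A] A) {N : ModuleCat.{u} (SkewMonoidAlgebra A G)} (n : N) : D.homs N where
  val :=
    { toFun := fun t => algOp (K := K) N (σ t) n
      map_add' := fun x y => by rw [map_add, algOp_add]
      map_smul' := fun c x => by
        change algOp (K := K) N (σ (algebraMap K A c • x)) n = _
        rw [map_smul, smul_eq_mul, algOp_mul]
        rfl }
  property a t := by
    change algOp (K := K) N (σ (a • t)) n = _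
    rw [map_smul, smul_eq_mul, algOp_mul]
    rfl

theorem homsFunctor_faithful [IsSemisimpleRing A] (hD : IsExhaustive D) :
    (homsFunctor D).Faithful where
  map_injective {M N} φ ψ h := by
    have := fun i => (D i).absSimple.1
    have := fun i => (this i).nontrivial
    choose s hs using fun i => exists_ne (0 : (D i).S)
    choose σ hσ using fun i => exists_linearMap_smul_self ((D i).absSimple.1) (hs i)
    ext m
    rw [← sub_eq_zero]
    refine hD.eq_zero (K := K) hs hσ fun i r => ?_
    -- The images of `φ` and `ψ` are compared on the homomorphism `t ↦ σ(t) r m`, evaluated at `s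
    -- i`.
    have h1 := congrArg (fun F => ((ProjRep.Hom.lin (F i)
      ((D i).homOfLinear (σ i) (r • m) : (D i).homs M)) : (D i).homs N).1 (s i)) h
    have h2 : φ (algOp (K := K) M (σ i (s i)) (r • m)) =
      ψ (algOp (K := K) M (σ i (s i)) (r • m)) := h1
    have h3 : φ (r • m) = r • φ m := φ.hom.map_smul r m
    have h4 : ψ (r • m) = r • ψ m := ψ.hom.map_smul r m
    rw [map_algOp, map_algOp, h3, h4] at h2
    rw [smul_sub, map_sub, sub_eq_zero]
    exact h2

/-- The submodule of `M × N` generated by the graphs of the maps `f(s) ↦ ψ_i(f)(s)`. -/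
def graphSpan {M N : ModuleCat.{u} (SkewMonoidAlgebra A G)}
    (ψ : ∀ i, (D i).homs M →ₗ[K] (D i).homs N) : Submodule (SkewMonoidAlgebra A G) (M × N) :=
  Submodule.span _ {p | ∃ (i : ι) (f : (D i).homs M) (s : (D i).S), p = (f.1 s, (ψ i f).1 s)}

/-- The idempotent `σ_i(s_i)` sends a translate of a generating pair to a pair of the same form,
based at `s_i`. If `g` stabilises `S_i` and `j = i`, moving `g` across `f` costs a conjugation, with
which `ψ` commutes, and Schur's lemma leaves a scalar; otherwise separation forces both entries to
vanish. -/
theorem graphSpan_aux (hD : IsSeparated D) {s : ∀ i, (D i).S} {σ : ∀ i, (D i).S →ₗ[A] A}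
    {M N : ModuleCat.{u} (SkewMonoidAlgebra A G)} {ψ : ∀ i, (D i).homs M →ₗ[K] (D i).homs N}
    (hψ : ∀ i h f, ψ i ((D i).conj M h f) = (D i).conj N h (ψ i f)) (i j : ι) (g : G) (a : A)
    (f : (D j).homs M) (t : (D j).S) :
    ∃ f' : (D i).homs M,
      algOp (K := K) M (σ i (s i))
        ((SkewMonoidAlgebra.single g a : SkewMonoidAlgebra A G) • f.1 t) = f'.1 (s i) ∧
      algOp (K := K) N (σ i (s i))
        ((SkewMonoidAlgebra.single g a : SkewMonoidAlgebra A G) • (ψ j f).1 t) =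
          (ψ i f').1 (s i) := by
  by_cases hij : i = j ∧ g⁻¹ ∈ H i
  · obtain ⟨rfl, hg⟩ := hij
    rw [inv_mem_iff] at hg
    let t' := (D i).lin ⟨g, hg⟩ t
    -- The endomorphism `x ↦ σ_i(x) a t'` of `S_i` is a scalar `c`. It does not depend on `f`, so
    -- the same `c` serves for `M` and for `N`.
    obtain ⟨c, hc⟩ := (D i).absSimple.2
      ((LinearMap.toSpanSingleton A (D i).S (a • t')).comp (σ i))
    have hc' : (σ i (s i) * a) • t' = c • s i := by
      rw [mul_smul]
      exact hc (s i)
    have key : ∀ {N : ModuleCat.{u} (SkewMonoidAlgebra A G)} (f : (D i).homs N),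
        algOp (K := K) N (σ i (s i))
          ((SkewMonoidAlgebra.single g a : SkewMonoidAlgebra A G) • f.1 t) =
        (c • (D i).conj N ⟨g, hg⟩ f).1 (s i) := by
      intro N f
      have h1 : grpOp (K := K) N g (f.1 t) = ((D i).conj N ⟨g, hg⟩ f).1 t' := by
        rw [LiftedSimple.conj_apply, LinearEquiv.symm_apply_apply]
      rw [single_smul_eq (K := K), h1, ← algOp_mul, ← intertwiners_map, hc', map_smul]
      rfl
    refine ⟨c • (D i).conj M ⟨g, hg⟩ f, key f, ?_⟩
    rw [(ψ i).map_smul, hψ]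
    exact key (ψ i f)
  · have h0 : ∀ r : A, (g⁻¹ • (σ i (s i) * r)) • t = 0 := by
      intro r
      -- For fixed `r` and `t` the map `x ↦ g⁻¹(σ_i(x) r) t` is `g⁻¹`-semilinear from `S_i` to
      -- `S_j`.
      have := hD.eq_zero (i := i) (j := j) hij
        { toFun := fun x => (g⁻¹ • (σ i x * r)) • t
          map_zero' := by simp
          map_add' := fun x y => by rw [map_add, add_mul, smul_add, add_smul] }
        (fun b x => by
          change (g⁻¹ • (σ i (b • x) * r)) • t = (g⁻¹ • b) • (g⁻¹ • (σ i x * r)) • t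
          rw [map_smul, smul_eq_mul, mul_assoc, smul_mul', mul_smul])
      exact DFunLike.congr_fun this (s i)
    have key : ∀ {N : ModuleCat.{u} (SkewMonoidAlgebra A G)} (f : (D j).homs N),
        algOp (K := K) N (σ i (s i))
          ((SkewMonoidAlgebra.single g a : SkewMonoidAlgebra A G) • f.1 t) = 0 := by
      intro N f
      have h1 : σ i (s i) * a = g • g⁻¹ • (σ i (s i) * a) := by simp
      rw [single_smul_eq (K := K), ← algOp_mul, h1, ← grpOp_algOp, ← intertwiners_map, h0, map_zero,
        map_zero]
    refine ⟨0, key f, ?_⟩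
    rw [key, map_zero]
    rfl

/-- Seen through the idempotents, the generated submodule contains nothing beyond the graphs of the
`ψ_i`. This makes its projection to `M` injective. -/
theorem graphSpan_spec (hD : IsSeparated D) {s : ∀ i, (D i).S} {σ : ∀ i, (D i).S →ₗ[A] A}
    {M N : ModuleCat.{u} (SkewMonoidAlgebra A G)} {ψ : ∀ i, (D i).homs M →ₗ[K] (D i).homs N}
    (hψ : ∀ i h f, ψ i ((D i).conj M h f) = (D i).conj N h (ψ i f)) {p : M × N}
    (hp : p ∈ graphSpan ψ) (i : ι) :
    ∃ f : (D i).homs M, algOp (K := K) M (σ i (s i)) p.1 = f.1 (s i) ∧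
      algOp (K := K) N (σ i (s i)) p.2 = (ψ i f).1 (s i) := by
  -- The multiplier `r` lets the induction on the span absorb scalars.
  suffices h : ∀ r : SkewMonoidAlgebra A G, ∃ f : (D i).homs M,
      algOp (K := K) M (σ i (s i)) (r • p.1) = f.1 (s i) ∧
      algOp (K := K) N (σ i (s i)) (r • p.2) = (ψ i f).1 (s i) by
    simpa using h 1
  induction hp using Submodule.span_induction with
  | zero => exact fun r => ⟨0, by simp, by simp⟩
  | smul r' p _ hp =>
    intro r
    obtain ⟨f, h1, h2⟩ := hp (r * r')
    exact ⟨f, by rw [← h1, mul_smul]; rfl, by rw [← h2, mul_smul]; rfl⟩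
  | add p q _ _ hp hq =>
    intro r
    obtain ⟨f, h1, h2⟩ := hp r
    obtain ⟨f', h3, h4⟩ := hq r
    refine ⟨f + f', ?_, ?_⟩
    · rw [Prod.fst_add, smul_add, map_add, h1, h3]
      rfl
    · rw [Prod.snd_add, smul_add, map_add, h2, h4, map_add]
      rfl
  | mem p hp =>
    obtain ⟨j, f, t, rfl⟩ := hp
    intro r
    induction r using SkewMonoidAlgebra.induction_on with
    | zero => exact ⟨0, by simp, by simp⟩
    | single g a => exact graphSpan_aux hD hψ i j g a f t
    | add r r' hr hr' =>
      obtain ⟨f, h1, h2⟩ := hr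
      obtain ⟨f', h3, h4⟩ := hr'
      refine ⟨f + f', ?_, ?_⟩
      · rw [add_smul, map_add, h1, h3]
        rfl
      · rw [add_smul, map_add, h2, h4, map_add]
        rfl

/-- The submodule `Γ` projects isomorphically onto `M`, hence is the graph of a homomorphism, which
induces each `ψ_i` because `Γ` contains all pairs `(f(t), ψ_i(f)(t))`. -/
theorem homsFunctor_full [IsSemisimpleRing A] (hD : IsSeparated D) (hD' : IsExhaustive D) :
    (homsFunctor D).Full where
  map_surjective {M N} Ψ := by
    have := fun i => (D i).absSimple.1
    have := fun i => (this i).nontrivial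
    choose s hs using fun i => exists_ne (0 : (D i).S)
    choose σ hσ using fun i => exists_linearMap_smul_self ((D i).absSimple.1) (hs i)
    let ψ : ∀ i, (D i).homs M →ₗ[K] (D i).homs N := fun i => ProjRep.Hom.lin (Ψ i)
    have hψ : ∀ i h f, ψ i ((D i).conj M h f) = (D i).conj N h (ψ i f) :=
      fun i h f => ProjRep.Hom.comm (Ψ i) h f
    let Γ := graphSpan ψ
    let p₁ : Γ →ₗ[SkewMonoidAlgebra A G] M := (LinearMap.fst _ M N).comp Γ.subtype
    have hmem : ∀ i (f : (D i).homs M) t, (f.1 t, (ψ i f).1 t) ∈ Γ :=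
      fun i f t => Submodule.subset_span ⟨i, f, t, rfl⟩
    have inj : Function.Injective p₁ := by
      rw [injective_iff_map_eq_zero]
      rintro ⟨⟨m, n⟩, hmn⟩ (hm : m = 0)
      subst hm
      have : n = 0 := by
        refine hD'.eq_zero (K := K) hs hσ fun i r => ?_
        obtain ⟨f, h1, h2⟩ := graphSpan_spec hD (s := s) (σ := σ) hψ (Γ.smul_mem r hmn) i
        have h3 : f = 0 := intertwiners_ext (D i).absSimple.1 (hs i) (by
          rw [← h1]
          simp)
        rw [h3, map_zero] at h2
        exact h2
      exact Subtype.ext (Prod.ext rfl this)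
    have surj : Function.Surjective p₁ := by
      rw [← LinearMap.range_eq_top, Submodule.eq_top_iff']
      intro m
      rw [← Submodule.Quotient.mk_eq_zero]
      -- Detection is applied in the cokernel of `p₁`: each `σ_i(s_i) r m` is a value of `t ↦ σ_i(t)
      -- r m`, so it lies in the range.
      refine hD'.eq_zero (K := K) (N := ModuleCat.of _ (M ⧸ LinearMap.range p₁)) hs hσ
        fun i r => ?_
      refine (Submodule.Quotient.mk_eq_zero (LinearMap.range p₁)
        (x := algOp (K := K) M (σ i (s i)) (r • m))).2 ?_
      exact ⟨⟨_, hmem i ((D i).homOfLinear (σ i) (r • m)) (s i)⟩, rfl⟩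
    let e := LinearEquiv.ofBijective p₁ ⟨inj, surj⟩
    refine ⟨ModuleCat.ofHom (((LinearMap.snd _ M N).comp Γ.subtype).comp e.symm.toLinearMap),
      funext fun i => ProjRep.hom_ext (LinearMap.ext fun f => Subtype.ext (LinearMap.ext
        fun t => ?_))⟩
    have : e.symm (f.1 t) = ⟨_, hmem i f t⟩ := e.symm_apply_eq.2 rfl
    change ((e.symm (f.1 t) : Γ) : M × N).2 = (ψ i f).1 t
    rw [this]

end Family

/-! ### The tensor product of a lifted simple module and a projective representation -/

namespace LiftedSimple

variable {H : Subgroup G} {θ : Cocycle K H} (D : LiftedSimple A θ) (V : ProjRep θ)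

/-- The action of `A` on `S ⊗ V`. -/
def tensorAlgOp (a : A) : (D.S ⊗[K] V.V) →ₗ[K] (D.S ⊗[K] V.V) :=
  LinearMap.rTensor V.V (Algebra.lsmul K K D.S a)

/-- The action of `H` on `S ⊗ V`. -/
def tensorGrpOp (h : H) : (D.S ⊗[K] V.V) ≃ₗ[K] (D.S ⊗[K] V.V) :=
  TensorProduct.congr (D.lin h) (V.ρ h)

theorem tensorGrpOp_tmul (h : H) (s : D.S) (v : V.V) :
    D.tensorGrpOp V h (s ⊗ₜ v) = D.lin h s ⊗ₜ V.ρ h v := rfl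

theorem tensorAlgOp_tmul (a : A) (s : D.S) (v : V.V) :
    D.tensorAlgOp V a (s ⊗ₜ v) = (a • s) ⊗ₜ v := rfl

theorem tensorAlgOp_one : D.tensorAlgOp V 1 = LinearMap.id := by
  rw [tensorAlgOp, map_one]
  exact LinearMap.rTensor_id _ _

theorem tensorAlgOp_mul (a b : A) (t : D.S ⊗[K] V.V) :
    D.tensorAlgOp V (a * b) t = D.tensorAlgOp V a (D.tensorAlgOp V b t) := by
  induction t with
  | zero => simp
  | tmul s v => simp only [tensorAlgOp_tmul, mul_smul]
  | add x y hx hy => simp only [map_add, hx, hy]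

theorem tensorAlgOp_add (a b : A) :
    D.tensorAlgOp V (a + b) = D.tensorAlgOp V a + D.tensorAlgOp V b := by
  rw [tensorAlgOp, map_add]
  exact LinearMap.rTensor_add _ _ _

theorem tensorAlgOp_algebraMap (c : K) (t : D.S ⊗[K] V.V) :
    D.tensorAlgOp V (algebraMap K A c) t = c • t := by
  induction t with
  | zero => simp
  | tmul s v => rfl
  | add x y hx hy => rw [map_add, hx, hy, smul_add]

theorem tensorGrpOp_tensorAlgOp (h : H) (a : A) (t : D.S ⊗[K] V.V) :
    D.tensorGrpOp V h (D.tensorAlgOp V a t) =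
      D.tensorAlgOp V ((h : G) • a) (D.tensorGrpOp V h t) := by
  induction t with
  | zero => simp
  | tmul s v => simp only [tensorGrpOp_tmul, tensorAlgOp_tmul, lin_smul]
  | add x y hx hy => simp only [map_add, hx, hy]

/-- The cocycle `θ` of `V` cancels against its inverse on `S`, so `H` acts genuinely. -/
theorem tensorGrpOp_mul (g h : H) (t : D.S ⊗[K] V.V) :
    D.tensorGrpOp V (g * h) t = D.tensorGrpOp V g (D.tensorGrpOp V h t) := by
  induction t with
  | zero => simp
  | tmul s v =>
    simp only [tensorGrpOp_tmul]
    rw [V.ρ_mul, ← D.lin_mul, TensorProduct.smul_tmul]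
  | add x y hx hy => simp only [map_add, hx, hy]

/-- An invertible idempotent operator is the identity; `θ` need not be normalised. -/
theorem tensorGrpOp_one (t : D.S ⊗[K] V.V) : D.tensorGrpOp V 1 t = t := by
  apply (D.tensorGrpOp V 1).injective
  rw [← tensorGrpOp_mul, one_mul]

/-- Schur's lemma: `Hom_A(S, S ⊗ V) = V`. -/
theorem exists_eq_tmul (f : intertwiners D.S (D.tensorAlgOp V)) :
    ∃ v : V.V, ∀ s, f.1 s = s ⊗ₜ v := by
  -- `Hom_A(S, S ⊗ V)` is `End_A(S) ⊗ V`, and `End_A(S)` consists of scalars.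
  obtain ⟨t, rfl⟩ := (intertwinersTensor_bijective (β := D.tensorAlgOp V)
    (α := fun a => Algebra.lsmul K K D.S a) D.absSimple.1 (LinearEquiv.refl K (D.S ⊗[K] V.V))
    fun _ _ => rfl).2 f
  induction t with
  | zero => exact ⟨0, fun s => by simp⟩
  | tmul φ v =>
    obtain ⟨c, hc⟩ := D.absSimple.2 { φ.1 with map_smul' := φ.2 }
    refine ⟨c • v, fun s => ?_⟩
    rw [← TensorProduct.smul_tmul]
    exact congrArg (fun x => x ⊗ₜ[K] v) (hc s)
  | add x y hx hy =>
    obtain ⟨v, hv⟩ := hx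
    obtain ⟨v', hv'⟩ := hy
    refine ⟨v + v', fun s => ?_⟩
    rw [map_add, TensorProduct.tmul_add, ← hv, ← hv']
    rfl

theorem eq_zero_of_tmul_eq_zero {s : D.S} (hs : s ≠ 0) {v : V.V} (h : s ⊗ₜ[K] v = 0) : v = 0 := by
  by_contra hv
  refine hs ((Module.forall_dual_apply_eq_zero_iff K s).1 fun φ => ?_)
  have := congrArg (TensorProduct.lid K V.V ∘ LinearMap.rTensor V.V φ) h
  simp only [Function.comp_apply, LinearMap.rTensor_tmul, TensorProduct.lid_tmul, map_zero] at this
  exact (smul_eq_zero.1 this).resolve_right hv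

end LiftedSimple

/-! ### Coinduced modules and essential surjectivity -/

section Family

variable {ι : Type u} {H : ι → Subgroup G} {θ : ∀ i, Cocycle K (H i)}
  (D : ∀ i, LiftedSimple A (θ i)) (V : ∀ i, ProjRep (θ i))

/-- The sum of the modules coinduced from `S_i ⊗ V_i`, as a space of functions. -/
def coindSubmodule : Submodule K (∀ i, G → (D i).S ⊗[K] (V i).V) where
  carrier := {φ | ∀ (i : ι) (h : H i) (g : G), φ i (h * g) = (D i).tensorGrpOp (V i) h (φ i g)}
  zero_mem' := fun i h g => by simp
  add_mem' := fun {φ ψ} hφ hψ i h g => by simp [hφ i h g, hψ i h g]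
  smul_mem' := fun c φ hφ i h g => by simp [hφ i h g]

/-- The action of `A` on the coinduced module. -/
def coindAlg : A →+* Module.End K (coindSubmodule D V) where
  toFun a :=
    { toFun := fun φ => ⟨fun i g => (D i).tensorAlgOp (V i) (g • a) (φ.1 i g), fun i h g => by
        change (D i).tensorAlgOp (V i) ((h * g : G) • a) (φ.1 i (h * g)) =
          (D i).tensorGrpOp (V i) h ((D i).tensorAlgOp (V i) (g • a) (φ.1 i g))
        rw [φ.2, (D i).tensorGrpOp_tensorAlgOp, mul_smul]⟩
      map_add' := fun φ ψ => Subtype.ext (funext fun i => funext fun g => map_add _ _ _)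
      map_smul' := fun c φ => Subtype.ext (funext fun i => funext fun g =>
        ((D i).tensorAlgOp (V i) (g • a)).map_smul c (φ.1 i g)) }
  map_one' := LinearMap.ext fun φ => Subtype.ext (funext fun i => funext fun g => by
    simp [LiftedSimple.tensorAlgOp_one])
  map_mul' a b := LinearMap.ext fun φ => Subtype.ext (funext fun i => funext fun g => by
    simp [LiftedSimple.tensorAlgOp_mul])
  map_zero' := LinearMap.ext fun φ => Subtype.ext (funext fun i => funext fun g => by
    simp [LiftedSimple.tensorAlgOp])
  map_add' a b := LinearMap.ext fun φ => Subtype.ext (funext fun i => funext fun g => by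
    simp [LiftedSimple.tensorAlgOp_add])

/-- The action of `G` on the coinduced module by right translation. -/
def coindGrp : G →* Module.End K (coindSubmodule D V) where
  toFun x :=
    { toFun := fun φ => ⟨fun i g => φ.1 i (g * x), fun i h g => by
        change φ.1 i (h * g * x) = (D i).tensorGrpOp (V i) h (φ.1 i (g * x))
        rw [mul_assoc, φ.2]⟩
      map_add' := fun φ ψ => rfl
      map_smul' := fun c φ => rfl }
  map_one' := LinearMap.ext fun φ => Subtype.ext (funext fun i => funext fun g => by simp)
  map_mul' x y := LinearMap.ext fun φ => Subtype.ext (funext fun i => funext fun g => by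
    simp [mul_assoc])

/-- The action of `A * G` on the coinduced module. -/
def coindAct : SkewMonoidAlgebra A G →+* Module.End K (coindSubmodule D V) :=
  SkewMonoidAlgebra.liftNCRingHom (coindAlg D V) (coindGrp D V) (by
    intro a x
    refine LinearMap.ext fun φ => Subtype.ext (funext fun i => funext fun g => ?_)
    simp [coindAlg, coindGrp, mul_smul])

/-- The underlying group of the coinduced module. -/
def Coind : Type u := coindSubmodule D V

instance : AddCommGroup (Coind D V) := inferInstanceAs (AddCommGroup (coindSubmodule D V))

instance : Module (SkewMonoidAlgebra A G) (Coind D V) :=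
  Module.compHom (coindSubmodule D V) (coindAct D V)

/-- The sum of the modules coinduced from `S_i ⊗ V_i`. -/
def coind : ModuleCat.{u} (SkewMonoidAlgebra A G) :=
  ModuleCat.of (SkewMonoidAlgebra A G) (Coind D V)

variable {D V}

/-- The values of an element of the coinduced module. -/
def coindVal (φ : coind D V) (i : ι) (g : G) : (D i).S ⊗[K] (V i).V :=
  (show coindSubmodule D V from φ).1 i g

theorem coindVal_ext {φ ψ : coind D V} (h : ∀ i g, coindVal φ i g = coindVal ψ i g) : φ = ψ :=
  Subtype.ext (funext fun i => funext fun g => h i g)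

theorem coindVal_mul (φ : coind D V) (i : ι) (h : H i) (g : G) :
    coindVal φ i (h * g) = (D i).tensorGrpOp (V i) h (coindVal φ i g) :=
  (show coindSubmodule D V from φ).2 i h g

theorem coindVal_algOp (a : A) (φ : coind D V) (i : ι) (g : G) :
    coindVal (algOp (K := K) (coind D V) a φ) i g =
      (D i).tensorAlgOp (V i) (g • a) (coindVal φ i g) := by
  have : coindAct D V (SkewMonoidAlgebra.single 1 a) = coindAlg D V a := by
    refine (SkewMonoidAlgebra.liftNC_single _ _ _ _).trans ?_
    rw [map_one, mul_one]
    rfl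
  exact congrArg (fun F : Module.End K (coindSubmodule D V) =>
    (F (show coindSubmodule D V from φ)).1 i g) this

theorem coindVal_grpOp (x : G) (φ : coind D V) (i : ι) (g : G) :
    coindVal (grpOp (K := K) (coind D V) x φ) i g = coindVal φ i (g * x) := by
  have : coindAct D V (SkewMonoidAlgebra.single x 1) = coindGrp D V x := by
    refine (SkewMonoidAlgebra.liftNC_single _ _ _ _).trans ?_
    change coindAlg D V 1 * _ = _
    rw [map_one, one_mul]
  exact congrArg (fun F : Module.End K (coindSubmodule D V) =>
    (F (show coindSubmodule D V from φ)).1 i g) this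

theorem coindVal_smul (c : K) (φ : coind D V) (i : ι) (g : G) :
    coindVal (c • φ) i g = c • coindVal φ i g := by
  rw [smul_eq_algOp, coindVal_algOp, smul_algebraMap, LiftedSimple.tensorAlgOp_algebraMap]

/-- The projection of the coinduced module to a factor. -/
def coindProj (i : ι) (g : G) : coind D V →ₗ[K] (D i).S ⊗[K] (V i).V where
  toFun φ := coindVal φ i g
  map_add' _ _ := rfl
  map_smul' c φ := coindVal_smul c φ i g

open Classical in
/-- The function supported on `H_i` with value `t` at `1`. -/
def coindExtFun (i : ι) : (D i).S ⊗[K] (V i).V →ₗ[K] ∀ j, G → (D j).S ⊗[K] (V j).V :=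
  LinearMap.single K (fun j => G → (D j).S ⊗[K] (V j).V) i ∘ₗ LinearMap.pi fun g =>
    if hg : g ∈ H i then ((D i).tensorGrpOp (V i) ⟨g, hg⟩).toLinearMap else 0

theorem coindExtFun_of_mem {i : ι} {g : G} (hg : g ∈ H i) (t : (D i).S ⊗[K] (V i).V) :
    coindExtFun (D := D) (V := V) i t i g = (D i).tensorGrpOp (V i) ⟨g, hg⟩ t := by
  simp [coindExtFun, hg]

theorem coindExtFun_of_notMem {i : ι} {g : G} (hg : g ∉ H i) (t : (D i).S ⊗[K] (V i).V) :
    coindExtFun (D := D) (V := V) i t i g = 0 := by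
  simp [coindExtFun, hg]

theorem coindExtFun_of_ne {i j : ι} (hj : j ≠ i) (g : G) (t : (D i).S ⊗[K] (V i).V) :
    coindExtFun (D := D) (V := V) i t j g = 0 := by
  simp [coindExtFun, hj]

theorem coindExtFun_mem (i : ι) (t : (D i).S ⊗[K] (V i).V) :
    coindExtFun i t ∈ coindSubmodule D V := by
  intro j h g
  rcases eq_or_ne j i with rfl | hj
  · by_cases hg : g ∈ H j
    · rw [coindExtFun_of_mem hg, coindExtFun_of_mem ((H j).mul_mem h.2 hg),
        ← LiftedSimple.tensorGrpOp_mul]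
      rfl
    · rw [coindExtFun_of_notMem hg, coindExtFun_of_notMem fun h' =>
        hg (((H j).mul_mem_cancel_left h.2).1 h'), map_zero]
  · rw [coindExtFun_of_ne hj, coindExtFun_of_ne hj, map_zero]

/-- The element of the coinduced module supported on `H_i` with value `t` at `1`. -/
def coindExt (i : ι) : (D i).S ⊗[K] (V i).V →ₗ[K] coind D V :=
  let φ (t : (D i).S ⊗[K] (V i).V) : coind D V :=
    (⟨coindExtFun i t, coindExtFun_mem i t⟩ : coindSubmodule D V)
  { toFun := φ
    map_add' := fun t t' => coindVal_ext fun j g =>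
      congrFun (congrFun (map_add (coindExtFun i) t t') j) g
    map_smul' := fun c t => coindVal_ext fun j g =>
      (congrFun (congrFun (map_smul (coindExtFun i) c t) j) g).trans
        (coindVal_smul c (φ t) j g).symm }

theorem coindVal_coindExt (i : ι) (t : (D i).S ⊗[K] (V i).V) (j : ι) (g : G) :
    coindVal (coindExt (D := D) (V := V) i t) j g = coindExtFun i t j g := rfl

theorem coindExt_tensorAlgOp (i : ι) (a : A) (t : (D i).S ⊗[K] (V i).V) :
    coindExt (D := D) (V := V) i ((D i).tensorAlgOp (V i) a t) =
      algOp (K := K) (coind D V) a (coindExt i t) := by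
  refine coindVal_ext fun j g => ?_
  rw [coindVal_algOp, coindVal_coindExt, coindVal_coindExt]
  rcases eq_or_ne j i with rfl | hj
  · by_cases hg : g ∈ H j
    · rw [coindExtFun_of_mem hg, coindExtFun_of_mem hg, LiftedSimple.tensorGrpOp_tensorAlgOp]
    · rw [coindExtFun_of_notMem hg, coindExtFun_of_notMem hg, map_zero]
  · rw [coindExtFun_of_ne hj, coindExtFun_of_ne hj, map_zero]

theorem coindExt_tensorGrpOp (i : ι) (h : H i) (t : (D i).S ⊗[K] (V i).V) :
    coindExt (D := D) (V := V) i ((D i).tensorGrpOp (V i) h t) =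
      grpOp (K := K) (coind D V) (h : G) (coindExt i t) := by
  refine coindVal_ext fun j g => ?_
  rw [coindVal_grpOp, coindVal_coindExt, coindVal_coindExt]
  rcases eq_or_ne j i with rfl | hj
  · by_cases hg : g ∈ H j
    · rw [coindExtFun_of_mem hg, coindExtFun_of_mem ((H j).mul_mem hg h.2),
        ← LiftedSimple.tensorGrpOp_mul]
      rfl
    · rw [coindExtFun_of_notMem hg, coindExtFun_of_notMem fun h' =>
        hg (((H j).mul_mem_cancel_right h.2).1 h')]
  · rw [coindExtFun_of_ne hj, coindExtFun_of_ne hj]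

/-- The map `V_i → Hom_A(S_i, M)` for the coinduced module `M`. -/
def coindHom (D : ∀ i, LiftedSimple A (θ i)) (V : ∀ i, ProjRep (θ i)) (i : ι) :
    (V i).V →ₗ[K] (D i).homs (coind D V) where
  toFun v := ⟨coindExt i ∘ₗ (TensorProduct.mk K (D i).S (V i).V).flip v, fun a s =>
    coindExt_tensorAlgOp i a (s ⊗ₜ v)⟩
  map_add' v v' := Subtype.ext (LinearMap.ext fun s => by simp)
  map_smul' c v := Subtype.ext (LinearMap.ext fun s => by simp)

theorem coindHom_apply (i : ι) (v : (V i).V) (s : (D i).S) :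
    (coindHom D V i v).1 s = coindExt i (s ⊗ₜ v) := rfl

theorem coindVal_coindHom_one (i : ι) (v : (V i).V) (s : (D i).S) :
    coindVal ((coindHom D V i v).1 s) i 1 = s ⊗ₜ v := by
  rw [coindHom_apply, coindVal_coindExt, coindExtFun_of_mem (H i).one_mem]
  exact (D i).tensorGrpOp_one (V i) _

theorem coindHom_comm (i : ι) (h : H i) (v : (V i).V) :
    coindHom D V i ((V i).ρ h v) = (D i).conj (coind D V) h (coindHom D V i v) := by
  refine Subtype.ext (LinearMap.ext fun s => ?_)
  rw [LiftedSimple.conj_apply, coindHom_apply, coindHom_apply, ← coindExt_tensorGrpOp,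
    LiftedSimple.tensorGrpOp_tmul, LinearEquiv.apply_symm_apply]

/-- On the value at `g`, an element `a` acts through `g(a)`, so each coordinate of `s ↦ f(s)(g)`
along a basis of `V_j` is a `g`-semilinear map `S_i → S_j`; separation kills it. -/
theorem IsSeparated.coindVal_eq_zero (hD : IsSeparated D) {i j : ι} {g : G}
    (h : ¬ (i = j ∧ g ∈ H i)) (f : (D i).homs (coind D V)) (s : (D i).S) :
    coindVal (f.1 s) j g = 0 := by
  classical
  let b := Module.Basis.ofVectorSpace K (V j).V
  let E := TensorProduct.equivFinsuppOfBasisRight (M := (D j).S) b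
  have hE : ∀ (a : A) t k, E ((D j).tensorAlgOp (V j) a t) k = a • E t k := by
    intro a t k
    induction t with
    | zero => simp
    | tmul s v =>
      rw [LiftedSimple.tensorAlgOp_tmul,
        TensorProduct.equivFinsuppOfBasisRight_apply_tmul_apply,
        TensorProduct.equivFinsuppOfBasisRight_apply_tmul_apply, smul_comm]
    | add x y hx hy => simp only [map_add, Finsupp.add_apply, hx, hy, smul_add]
  apply E.injective
  rw [map_zero]
  ext k
  have := hD.eq_zero h (Finsupp.lapply k ∘ₗ E.toLinearMap ∘ₗ coindProj j g ∘ₗ f.1).toAddMonoidHom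
    fun a s => by
      change E (coindVal (f.1 (a • s)) j g) k = _
      rw [f.2, coindVal_algOp, hE]
      rfl
  exact DFunLike.congr_fun this s

/-- A homomorphism from `S_i` takes values supported on `H_i` in the component `i`, so by
equivariance it is determined by its value at `1`, which has the form `s ↦ s ⊗ v` by Schur's lemma.
-/
theorem IsSeparated.coindHom_bijective (hD : IsSeparated D) (i : ι) :
    Function.Bijective (coindHom D V i) := by
  constructor
  · rw [injective_iff_map_eq_zero]
    intro v hv
    have := (D i).absSimple.1.nontrivial
    obtain ⟨s, hs⟩ := exists_ne (0 : (D i).S)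
    refine (D i).eq_zero_of_tmul_eq_zero (V i) hs ?_
    rw [← coindVal_coindHom_one (D := D), hv]
    rfl
  · intro f
    obtain ⟨v, hv⟩ := (D i).exists_eq_tmul (V i) ⟨coindProj i 1 ∘ₗ f.1, fun a s => by
      change coindVal (f.1 (a • s)) i 1 = _
      rw [f.2, coindVal_algOp, one_smul]
      rfl⟩
    have hv' : ∀ s, coindVal (f.1 s) i 1 = s ⊗ₜ v := hv
    refine ⟨v, Subtype.ext (LinearMap.ext fun s => coindVal_ext fun j g => ?_)⟩
    by_cases h : i = j ∧ g ∈ H i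
    · obtain ⟨rfl, hg⟩ := h
      have h1 := coindVal_mul (f.1 s) i ⟨g, hg⟩ 1
      have h2 := coindVal_mul ((coindHom D V i v).1 s) i ⟨g, hg⟩ 1
      rw [mul_one] at h1 h2
      exact h2.trans ((congrArg _ ((coindVal_coindHom_one i v s).trans (hv' s).symm)).trans h1.symm)
    · rw [hD.coindVal_eq_zero h, hD.coindVal_eq_zero h]

/-- `Hom_A(S_i, M) = V_i` for the coinduced module `M`. -/
def IsSeparated.coindIso (hD : IsSeparated D) (V : ∀ i, ProjRep (θ i)) (i : ι) :
    V i ≅ (D i).homRep (coind D V) :=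
  ProjRep.isoMk (W := (D i).homRep (coind D V))
    (LinearEquiv.ofBijective (coindHom D V i) (hD.coindHom_bijective i)) (coindHom_comm i)

end Family

theorem homsFunctor_essSurj {ι : Type w} [Small.{u} ι] {H : ι → Subgroup G}
    {θ : ∀ i, Cocycle K (H i)} {D : ∀ i, LiftedSimple A (θ i)} (hD : IsSeparated D) :
    (homsFunctor D).EssSurj where
  mem_essImage V := by
    -- Reindexing keeps the coinduced module, a space of functions over all indices, in universe
    -- `u`.
    let e := (equivShrink.{u} ι).symm
    have hD' : IsSeparated fun i => D (e i) := fun i j g h =>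
      ⟨e.injective (hD _ _ g h).1, (hD _ _ g h).2⟩
    refine ⟨coind (fun i => D (e i)) fun i => V (e i), ⟨Pi.isoMk fun i => Nonempty.some ?_⟩⟩
    obtain ⟨i, rfl⟩ := e.surjective i
    exact ⟨(hD'.coindIso (fun i => V (e i)) i).symm⟩

/-! ### From decorated `G`-sets to lifted simple modules -/

theorem IrrSet.smul_mk_eq_mk_iff {g : G} {M N : ModuleCat.{u} A} {hM : IsAbsolutelySimple K M}
    {hN : IsAbsolutelySimple K N} :
    g • IrrSet.mk M hM = IrrSet.mk N hN ↔ ∃ T : M ≃+ N, IsSemi g T := by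
  constructor
  · intro h
    obtain ⟨e⟩ := IrrSet.mk_eq_mk.1 ((IrrSet.smul_mk g M hM).symm.trans h)
    have := (isSemi_twist g M).trans (isSemi_one (G := G) e)
    rw [one_mul] at this
    exact ⟨_, this⟩
  · rintro ⟨T, hT⟩
    exact IrrSet.mk_eq_of_isSemi (mul_inv_cancel g) ((isSemi_twist g M).symm.trans hT)

/-- A cocycle whose class is inverse to the class of an obstruction cocycle is inverse to another
obstruction cocycle of the same module. -/
theorem IsLift.exists_liftedSimple {M : ModuleCat.{u} A} (hM : IsAbsolutelySimple K M)
    {H : Subgroup G} {T : H → (M ≃+ M)} {η θ : Cocycle K H} (h : IsLift M H T η)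
    (hθ : θ.cls = -η.cls) : ∃ D : LiftedSimple A θ, D.S = M := by
  have h1 : groupCohomology.H2π (unitsRep K H) θ = groupCohomology.H2π (unitsRep K H) (-η) :=
    hθ.trans (map_neg (groupCohomology.H2π (unitsRep K H)).hom η).symm
  obtain ⟨c, hc⟩ := (groupCohomology.H2π_eq_iff θ (-η)).1 h1
  -- `θ η` is the coboundary of `d`; hence replacing `T_g` by `d_g⁻¹ T_g` changes the obstruction
  -- from `η` to `θ⁻¹`.
  let d : H → Kˣ := fun g => Additive.toMul (c g : Additive Kˣ)
  have hd : ∀ g h : H, θ.val g h * d (g * h) * η.val g h = d g * d h := by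
    intro g k
    have h2 : d k / d (g * k) * d g = θ.val g k / (η.val g k)⁻¹ := congrFun hc (g, k)
    rw [div_mul_eq_mul_div, div_inv_eq_mul, div_eq_iff_eq_mul] at h2
    rw [mul_comm (d g), h2]
    exact mul_right_comm _ _ _
  refine ⟨⟨M, hM, fun g => (T g).trans (DistribMulAction.toAddEquiv M (d g)⁻¹), ?_, ?_⟩, rfl⟩
  · intro g a m
    change (((d g)⁻¹ : Kˣ) : K) • T g (a • m) = _ • (((d g)⁻¹ : Kˣ) : K) • T g m
    rw [h.semi, smul_comm]
  · intro g k m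
    change (θ.val g k : K) • (((d g)⁻¹ : Kˣ) : K) • T g ((((d k)⁻¹ : Kˣ) : K) • T k m) =
      (((d (g * k))⁻¹ : Kˣ) : K) • T (g * k) m
    have h3 : T g ((((d k)⁻¹ : Kˣ) : K) • T k m) = (((d k)⁻¹ : Kˣ) : K) • T g (T k m) :=
      (h.semi g).map_scalar _ _
    have h4 : T g (T k m) = (η.val g k : K) • T (g * k) m := h.mul g k m
    rw [h3, h4, smul_smul, smul_smul, smul_smul, ← Units.val_mul, ← Units.val_mul, ← Units.val_mul]
    congr 2
    rw [eq_inv_iff_mul_eq_one]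
    have := hd g k
    calc _ = (θ.val g k * d (g * k) * η.val g k) * (d g * d k)⁻¹ := by
          rw [mul_inv]
          ac_rfl
      _ = 1 := by rw [this, mul_inv_cancel]

/-- The frill of `φ(x)` is the obstruction class of some representative; pulling its lift back along
`G_x → G_{φ(x)}` computes the frill of `x`. -/
theorem DecoratedGSet.Iso.exists_liftedSimple {X : DecoratedGSet.{u, w} K G}
    (φ : X.Iso (Irr K G A)) (x : X.carrier) (θ : Cocycle K (MulAction.stabilizer G x))
    (hθ : θ.cls = -X.frill x) :
    ∃ D : LiftedSimple A θ, φ.toEquiv x = IrrSet.mk D.S D.absSimple := by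
  obtain ⟨M, hM, T, η, hx, hT, hη⟩ :=
    (IrrSet.existsUnique_frill (K := K) (G := G) (A := A) (φ.toEquiv x)).choose_spec.1
  let f := stabMap φ.toEquiv φ.map_smul x
  obtain ⟨η', h1, h2⟩ := Mu.pullback_cls f η
  have h3 : X.frill x = η'.cls := by
    rw [φ.map_frill, ← h1]
    exact congrArg _ hη
  have h4 : IsLift M (MulAction.stabilizer G x) (fun g => T (f g)) η' :=
    ⟨fun g => hT.semi (f g), fun g h m => by
      rw [h2, map_mul]
      exact hT.mul _ _ m⟩
  obtain ⟨D, rfl⟩ := h4.exists_liftedSimple hM (hθ.trans (congrArg _ h3))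
  exact ⟨D, hx⟩

end LabelDuality

end

/-! ### The equivalence of module categories -/

open LabelDuality

theorem mainTheorem7 {K G : Type u} [Field K] [Group G] [Finite G]
    (X : DecoratedGSet.{u, w} K G) [Finite X.carrier]
    (X₀ : Set X.carrier) (hX₀ : ∀ x : X.carrier, ∃! y, y ∈ X₀ ∧ y ∈ MulAction.orbit G x)
    (θ : ∀ x : X₀, Cocycle K (MulAction.stabilizer G (x : X.carrier)))
    (hθ : ∀ x : X₀, (θ x).cls = -X.frill x)
    (A : Type u) [Ring A] [Algebra K A] [MulSemiringAction G A] [SMulCommClass G K A]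
    (hA : IsSplitSemisimple K A) (hAX : Nonempty (X.Iso (Irr K G A))) :
    ModuleCategoryEquivalent K (Rep.{u} K G)
      (EquivariantSheaves G A) (∀ x : X₀, ProjRep (θ x)) := by
  obtain ⟨φ⟩ := hAX
  obtain ⟨hss, hsplit⟩ := hA
  choose D hD using fun x : X₀ => φ.exists_liftedSimple x (θ x) (hθ x)
  have hsep : IsSeparated D := by
    intro i j g hT
    have h1 : g • IrrSet.mk (D i).S (D i).absSimple = IrrSet.mk (D j).S (D j).absSimple :=
      IrrSet.smul_mk_eq_mk_iff.2 hT
    rw [← hD, ← hD] at h1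
    have h2 : g • (i : X.carrier) = j :=
      φ.toEquiv.injective ((φ.map_smul g i).trans h1)
    -- Both `i` and `j = g • i` are representatives of the orbit of `i`.
    have h3 : i = j := Subtype.ext ((hX₀ i).unique ⟨i.2, MulAction.mem_orbit_self _⟩
      ⟨j.2, ⟨g, h2⟩⟩)
    exact ⟨h3, MulAction.mem_stabilizer_iff.2 (h2.trans (congrArg Subtype.val h3.symm))⟩
  have hexh : IsExhaustive D := by
    intro L hL
    obtain ⟨x, hx⟩ := φ.toEquiv.surjective (IrrSet.mk L (hsplit L hL))
    -- Here `h • x = y`, so the simple module `L` is the twist of `S_y` by `h⁻¹`.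
    obtain ⟨y, ⟨hy, h, hxy⟩, -⟩ := hX₀ x
    have h1 : h⁻¹ • y = x := by
      rw [← hxy]
      exact inv_smul_smul h x
    refine ⟨⟨y, hy⟩, h⁻¹, (IrrSet.smul_mk_eq_mk_iff (hM := (D ⟨y, hy⟩).absSimple)
      (hN := hsplit L hL)).1 ?_⟩
    rw [← hD, ← hx, ← h1]
    exact (φ.map_smul h⁻¹ y).symm
  have := homsFunctor_faithful hexh
  have := homsFunctor_full hsep hexh
  have := homsFunctor_essSurj hsep
  exact ⟨homsFunctor D, {}, inferInstance, inferInstance, ⟨rightLinearOfIsIso (homsFunctor D)⟩⟩
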